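/- Let $A=\{0,1\}$. A right-ideal homomorphism is a partial function $\varphi:A^*\to A^*$ whose domain is a finitely generated right ideal of $A^*$ and which satisfies $\varphi(xz)=\varphi(x)z$ for all $x\in\mathrm{Dom}(\varphi)$, $z\in A^*$. It has a unique maximum essential extension $\max(\varphi)$ (an extension $\psi$ of $\varphi$ is essential if $\mathrm{Dom}(\varphi)$ meets every right ideal that $\mathrm{Dom}(\psi)$ meets). The Thompson–Higman monoid $M_{2,1}$ consists of all maximal right-ideal homomorphisms, with product $\varphi\cdot\psi=\max(\varphi\circ\psi)$. The Thompson group $G_{2,1}$ is its group of invertible elements, $lpG_{2,1}=\{g\in G_{2,1}: |g(x)|=|x| \text{ for all } x\in\mathrm{Dom}(g)\}$, and $lepM_{2,1}$ is the submonoid of $M_{2,1}$ of all elements that are represented by a homomorphism $\varphi: PA^*\to QA^*$ ($P,Q$ finite prefix codes, $P$ maximal, $\mathrm{Im}(\varphi)=QA^*$) such that $|x_1|=|x_2|$ implies $|\varphi(x_1)|=|\varphi(x_2)|$. Let $\tau=\{\tau_{i,j}:1\le i<j\}$ be the set of position transpositions ($\tau_{i,j}$ exchanges the $i$th and $j$th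 letters of a word). Let $\Gamma_G\subset G_{2,1}$, $\Gamma_{lepM}\subset lepM_{2,1}$, $\Gamma_M\subset M_{2,1}$ be finite sets such that $\Gamma_G=\Gamma_G^{-1}$ and such that $\Gamma_G\cup\tau$, $\Gamma_{lepM}\cup\tau$, $\Gamma_M\cup\tau$ generate $G_{2,1}$, $lepM_{2,1}$, $M_{2,1}$, respectively; let $|\cdot|_{lepM_{2,1}}$ and $|\cdot|_{M_{2,1}}$ be the word-lengths over $\Gamma_{lepM}\cup\tau$ and $\Gamma_M\cup\tau$. Let $F=\{g\in G_{2,1}: g(x)=x \text{ for all } x\in 0A^*\}$, and for $g\in G_{2,1}$ let $(g)_0\in G_{2,1}$ be given by $0x\mapsto 0\,g(x)$, $1x\mapsto 1x$. Let $d$ be the path distance in the Schreier graph with vertex set $G_{2,1}/F$ (left cosets) and edges $hF\to\gamma hF$ ($h\in G_{2,1}$, $\gamma\in\Gamma_G\cup\tau$), and let $D(g,g')=d\big((g)_0F,(g')_0F\big)$. For $n\in\mathbb N$ define $$\Delta(n)=\max\{D(\mathbf 1,g): g\in lpG_{2,1},\ |g|_{lepM_{2,1}}\le n\},\qquad \delta(n)=\max\{D(\mathbf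 1,g): g\in lpG_{2,1},\ |g|_{M_{2,1}}\le n\}.$$ **Proposition.** These maxima exist (and are finite), and the functions $\Delta$ and $\delta$ are polynomially related, i.e. there are positive integers $a_0,a_1,a_2,d,e$ such that $\Delta(n)\le a_1\,\delta(a_1n^d)^d$ and $\delta(n)\le a_2\,\Delta(a_2n^e)^e$ for all $n\ge a_0$. More precisely, there are integer constants $c_0,c',c_1,c_2\ge 1$ such that for all $n\in\mathbb N$: $$\Delta(n)\ \le\ c_1\,\delta(c_0n)\ \le\ c_2\,\Delta(c'n^2).$$ If $\Gamma_{lepM}\subseteq\Gamma_M\cup\tau$, then there are integer constants $c',c_1,c_2\ge1$ such that for all $n\in\mathbb N$: $$\Delta(n)\ \le\ c_1\,\delta(n)\ \le\ c_2\,\Delta(c'n^2).$$ -/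

import Mathlib

namespace Thompson

/-- Words over the alphabet `{0,1}`, with `0 = false` and `1 = true`. -/
abbrev Word : Type := List Bool

/-! ## Right ideals and prefix codes of the free monoid of words -/

/-- `R` is a right ideal: `R A* ⊆ R`. -/
def IsRightIdeal (R : Set Word) : Prop :=
  ∀ x ∈ R, ∀ z : Word, x ++ z ∈ R

/-- The right ideal `C A*` generated by `C`. -/
def genIdeal (C : Set Word) : Set Word :=
  {x | ∃ p ∈ C, p <+: x}

/-- A right ideal is essential if it meets every (nonempty) right ideal. -/
def Essential (R : Set Word) : Prop :=
  ∀ I : Set Word, IsRightIdeal I → I.Nonempty → (R ∩ I).Nonempty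

/-- `R'` is essential in `R` if `R'` meets every right ideal that `R` meets. -/
def EssentialIn (R' R : Set Word) : Prop :=
  ∀ I : Set Word, IsRightIdeal I → (R ∩ I).Nonempty → (R' ∩ I).Nonempty

/-- No element of `C` is a prefix of another element of `C`. -/
def IsPrefixCode (C : Set Word) : Prop :=
  ∀ x ∈ C, ∀ y ∈ C, x <+: y → x = y

/-- A prefix code that is not strictly contained in another prefix code. -/
def IsMaximalPrefixCode (C : Set Word) : Prop :=
  IsPrefixCode C ∧ ∀ C' : Set Word, IsPrefixCode C' → C ⊆ C' → C' = C

/-! ## Right-ideal homomorphisms -/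

/-- A right-ideal homomorphism with finitely generated domain, as a partial function on words.
Its image is then also a finitely generated right ideal. -/
@[ext]
structure RIHom where
  toFun : Word → Option Word
  map_append : ∀ x y z : Word, toFun x = some y → toFun (x ++ z) = some (y ++ z)
  fg : ∃ P : Set Word, P.Finite ∧ {x | (toFun x).isSome} = genIdeal P

namespace RIHom

/-- The domain. -/
def dom (f : RIHom) : Set Word := {x | ∃ y, f.toFun x = some y}

/-- The image. -/
def im (f : RIHom) : Set Word := {y | ∃ x, f.toFun x = some y}

theorem isSome_set_eq (f : RIHom) : {x | (f.toFun x).isSome} = f.dom := by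
  ext x; simp [dom, Option.isSome_iff_exists]

theorem dom_rightIdeal (f : RIHom) : IsRightIdeal f.dom := by
  rintro x ⟨y, hy⟩ z
  exact ⟨_, f.map_append _ _ z hy⟩

theorem im_rightIdeal (f : RIHom) : IsRightIdeal f.im := by
  rintro y ⟨x, hy⟩ z
  exact ⟨_, f.map_append _ _ z hy⟩

/-- `g` is an essential restriction of `f` (and `f` is an essential extension of `g`). -/
def EssRestr (g f : RIHom) : Prop :=
  (∀ x y, g.toFun x = some y → f.toFun x = some y) ∧ EssentialIn g.dom f.dom

/-- `f` has no proper essential extension. -/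
def IsMax (f : RIHom) : Prop :=
  ∀ g : RIHom, EssRestr f g → g = f

theorem essRestr_iff (g f : RIHom) : EssRestr g f ↔
    (∀ x y, g.toFun x = some y → f.toFun x = some y) ∧
      ∀ x ∈ f.dom, ∃ v, x ++ v ∈ g.dom := by
  refine and_congr_right fun _ => ⟨fun h x hx => ?_, fun h I hI => ?_⟩
  · obtain ⟨w, hw, v, rfl⟩ := h {w | x <+: w}
      (fun w hw z => hw.trans (List.prefix_append _ _)) ⟨x, hx, List.prefix_refl x⟩
    exact ⟨v, hw⟩
  · rintro ⟨x, hx, hxI⟩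
    obtain ⟨v, hv⟩ := h x hx
    exact ⟨x ++ v, hv, hI x hxI v⟩

theorem essRestr_refl (f : RIHom) : EssRestr f f :=
  ⟨fun _ _ h => h, fun _ _ h => h⟩

theorem EssRestr.trans {f g h : RIHom} (h₁ : EssRestr f g) (h₂ : EssRestr g h) :
    EssRestr f h :=
  ⟨fun x y hx => h₂.1 x y (h₁.1 x y hx), fun I hI hne => h₁.2 I hI (h₂.2 I hI hne)⟩

theorem ext_of_le {f g : RIHom} (h₁ : ∀ x y, f.toFun x = some y → g.toFun x = some y)
    (h₂ : ∀ x y, g.toFun x = some y → f.toFun x = some y) : f = g := by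
  ext x y
  exact ⟨h₁ x y, h₂ x y⟩

/-! ### The maximum essential extension -/

/-- `y` is the value at `x` of the maximum essential extension of `f`: every extension of `x`
can be extended into the domain of `f`, and there `f` acts as `x z ↦ y z`. -/
def MaxVal (f : RIHom) (x y : Word) : Prop :=
  (∀ u, ∃ v, x ++ u ++ v ∈ f.dom) ∧ ∀ z w, f.toFun (x ++ z) = some w → w = y ++ z

theorem MaxVal.unique {f : RIHom} {x y y' : Word} (h : f.MaxVal x y) (h' : f.MaxVal x y') :
    y = y' := by
  obtain ⟨v, w, hw⟩ := h.1 []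
  rw [List.append_nil] at hw
  exact List.append_cancel_right ((h.2 v w hw).symm.trans (h'.2 v w hw))

theorem MaxVal.append {f : RIHom} {x y : Word} (h : f.MaxVal x y) (z : Word) :
    f.MaxVal (x ++ z) (y ++ z) := by
  refine ⟨fun u => ?_, fun z' w hw => ?_⟩
  · obtain ⟨v, hv⟩ := h.1 (z ++ u)
    exact ⟨v, by simpa [List.append_assoc] using hv⟩
  · have := h.2 (z ++ z') w (by simpa [List.append_assoc] using hw)
    simpa [List.append_assoc] using this

theorem maxVal_of_eq {f : RIHom} {x y : Word} (h : f.toFun x = some y) : f.MaxVal x y := by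
  refine ⟨fun u => ⟨[], ?_⟩, fun z w hw => ?_⟩
  · rw [List.append_nil]
    exact ⟨_, f.map_append _ _ u h⟩
  · rw [f.map_append _ _ z h] at hw
    exact (Option.some.inj hw).symm

open Classical in
/-- The underlying partial function of the maximum essential extension. -/
noncomputable def maxFun (f : RIHom) (x : Word) : Option Word :=
  if h : ∃ y, f.MaxVal x y then some h.choose else none

theorem maxFun_eq_some {f : RIHom} {x y : Word} : f.maxFun x = some y ↔ f.MaxVal x y := by
  unfold maxFun
  split_ifs with h
  · constructor
    · intro e
      rw [← Option.some.inj e]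
      exact h.choose_spec
    · intro hy
      rw [h.choose_spec.unique hy]
  · constructor
    · intro e; cases e
    · intro hy; exact absurd ⟨y, hy⟩ h

/-- The maximum essential extension `max(f)`. -/
noncomputable def maxExt (f : RIHom) : RIHom where
  toFun := f.maxFun
  map_append x y z h := maxFun_eq_some.2 ((maxFun_eq_some.1 h).append z)
  fg := by
    obtain ⟨P, hP, hdom⟩ := f.fg
    rw [isSome_set_eq] at hdom
    obtain ⟨L, hL⟩ : ∃ L, ∀ p ∈ P, p.length ≤ L := by
      obtain ⟨L, hL⟩ := (hP.image List.length).bddAbove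
      exact ⟨L, fun p hp => hL ⟨p, hp, rfl⟩⟩
    refine ⟨{x | x.length ≤ L ∧ ∃ y, f.MaxVal x y},
      (List.finite_length_le Bool L).subset fun x hx => hx.1, ?_⟩
    ext x
    constructor
    · intro hx
      obtain ⟨y, hy⟩ := Option.isSome_iff_exists.1 hx
      replace hy := maxFun_eq_some.1 hy
      by_cases hlen : x.length ≤ L
      · exact ⟨x, ⟨hlen, y, hy⟩, List.prefix_refl x⟩
      · obtain ⟨v, hv⟩ := hy.1 []
        rw [List.append_nil, hdom] at hv
        obtain ⟨p, hp, hpx⟩ := hv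
        have hpx' : p <+: x :=
          List.prefix_of_prefix_length_le hpx (List.prefix_append _ _)
            ((hL p hp).trans (not_le.1 hlen).le)
        have hpd : p ∈ f.dom := by rw [hdom]; exact ⟨p, hp, List.prefix_refl p⟩
        obtain ⟨q, hq⟩ := hpd
        exact ⟨p, ⟨hL p hp, q, maxVal_of_eq hq⟩, hpx'⟩
    · rintro ⟨p, ⟨-, y, hy⟩, z, rfl⟩
      exact Option.isSome_iff_exists.2 ⟨_, maxFun_eq_some.2 (hy.append z)⟩

theorem maxExt_eq_some {f : RIHom} {x y : Word} :
    f.maxExt.toFun x = some y ↔ f.MaxVal x y := maxFun_eq_some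

theorem essRestr_maxExt (f : RIHom) : EssRestr f f.maxExt := by
  rw [essRestr_iff]
  refine ⟨fun x y h => maxExt_eq_some.2 (maxVal_of_eq h), ?_⟩
  rintro x ⟨y, hy⟩
  obtain ⟨v, hv⟩ := (maxExt_eq_some.1 hy).1 []
  exact ⟨v, by simpa using hv⟩

/-- `max(f)` extends every essential extension of `f`. -/
theorem EssRestr.le_maxExt {f g : RIHom} (h : EssRestr f g) :
    ∀ x y, g.toFun x = some y → f.maxExt.toFun x = some y := by
  intro x y hxy
  rw [essRestr_iff] at h
  refine maxExt_eq_some.2 ⟨fun u => h.2 _ ⟨_, g.map_append _ _ u hxy⟩, fun z w hw => ?_⟩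
  have h1 := h.1 _ _ hw
  rw [g.map_append _ _ z hxy] at h1
  exact (Option.some.inj h1).symm

theorem EssRestr.maxExt_eq {f g : RIHom} (h : EssRestr f g) : f.maxExt = g.maxExt := by
  have h1 : EssRestr g f.maxExt := by
    refine ⟨h.le_maxExt, fun I hI hne => ?_⟩
    obtain ⟨x, ⟨y, hy⟩, hx⟩ := (essRestr_maxExt f).2 I hI hne
    exact ⟨x, ⟨y, h.1 _ _ hy⟩, hx⟩
  exact ext_of_le h1.le_maxExt (h.trans (essRestr_maxExt g)).le_maxExt

theorem maxExt_isMax (f : RIHom) : f.maxExt.IsMax := by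
  intro g hg
  exact ext_of_le ((essRestr_maxExt f).trans hg).le_maxExt hg.1

theorem IsMax.maxExt_eq {f : RIHom} (h : f.IsMax) : f.maxExt = f :=
  h _ (essRestr_maxExt f)

/-! ### Identity and composition -/

/-- The identity on all words. -/
def id : RIHom where
  toFun := some
  map_append x y z h := by rw [Option.some.inj h]
  fg := ⟨{[]}, Set.finite_singleton _, by ext x; simp [genIdeal]⟩

/-- Composition of partial functions, `(f ∘ g)(x) = f (g x)`. -/
def comp (f g : RIHom) : RIHom where
  toFun x := (g.toFun x).bind f.toFun
  map_append x y z h := by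
    obtain ⟨w, hw, hy⟩ := Option.bind_eq_some_iff.1 h
    exact Option.bind_eq_some_iff.2 ⟨_, g.map_append _ _ z hw, f.map_append _ _ z hy⟩
  fg := by
    obtain ⟨P, hP, hgd⟩ := g.fg
    obtain ⟨Q, hQ, hfd⟩ := f.fg
    rw [isSome_set_eq] at hgd hfd
    refine ⟨{x | x ∈ Set.image2 (fun p q => p ++ q.drop ((g.toFun p).getD []).length) P Q ∧
      ∃ y, (g.toFun x).bind f.toFun = some y}, (hP.image2 _ hQ).subset fun x hx => hx.1, ?_⟩
    ext x
    constructor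
    · intro hx
      obtain ⟨y, hy⟩ := Option.isSome_iff_exists.1 hx
      obtain ⟨w, hw, hy'⟩ := Option.bind_eq_some_iff.1 hy
      have hxg : x ∈ g.dom := ⟨w, hw⟩
      rw [hgd] at hxg
      obtain ⟨p, hp, z, rfl⟩ := hxg
      have hpd : p ∈ g.dom := by rw [hgd]; exact ⟨p, hp, List.prefix_refl p⟩
      obtain ⟨r, hr⟩ := hpd
      rw [g.map_append _ _ z hr] at hw
      obtain rfl := Option.some.inj hw
      have hwf : r ++ z ∈ f.dom := ⟨y, hy'⟩
      rw [hfd] at hwf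
      obtain ⟨q, hq, hqr⟩ := hwf
      have hqd : q ∈ f.dom := by rw [hfd]; exact ⟨q, hq, List.prefix_refl q⟩
      have hkey : q <+: r ++ q.drop r.length ∧ q.drop r.length <+: z := by
        rcases le_total q.length r.length with hle | hle
        · rw [List.drop_eq_nil_of_le hle]
          refine ⟨?_, List.nil_prefix⟩
          rw [List.append_nil]
          exact List.prefix_of_prefix_length_le hqr (List.prefix_append _ _) hle
        · obtain ⟨t, rfl⟩ := List.prefix_of_prefix_length_le (List.prefix_append r z) hqr hle
          rw [List.drop_left]
          exact ⟨List.prefix_refl _, (List.prefix_append_right_inj r).1 hqr⟩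
      refine ⟨p ++ q.drop r.length, ⟨⟨p, hp, q, hq, by simp [hr]⟩, ?_⟩,
        (List.prefix_append_right_inj p).2 hkey.2⟩
      obtain ⟨t, ht⟩ := hkey.1
      obtain ⟨s, hs⟩ := hqd
      refine ⟨s ++ t, ?_⟩
      rw [g.map_append _ _ _ hr, Option.bind_some, ← ht]
      exact f.map_append _ _ t hs
    · rintro ⟨p, ⟨-, y, hy⟩, z, rfl⟩
      obtain ⟨w, hw, hy⟩ := Option.bind_eq_some_iff.1 hy
      refine Option.isSome_iff_exists.2 ⟨_, Option.bind_eq_some_iff.2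
        ⟨_, g.map_append _ _ z hw, f.map_append _ _ z hy⟩⟩

theorem comp_eq_some {f g : RIHom} {x y : Word} :
    (f.comp g).toFun x = some y ↔ ∃ w, g.toFun x = some w ∧ f.toFun w = some y :=
  Option.bind_eq_some_iff

theorem comp_assoc (f g h : RIHom) : (f.comp g).comp h = f.comp (g.comp h) := by
  ext x : 2
  simp [comp, Option.bind_assoc]

theorem id_comp (f : RIHom) : id.comp f = f := by
  ext x : 2
  simp [comp, id]

theorem comp_id (f : RIHom) : f.comp id = f := by
  ext x : 2
  simp [comp, id]

theorem id_isMax : id.IsMax := by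
  intro g hg
  refine ext_of_le (fun x y h => ?_) hg.1
  have h2 := hg.1 x x rfl
  rw [h] at h2
  rw [Option.some.inj h2]
  rfl

theorem EssRestr.comp {f f' g g' : RIHom} (hf : EssRestr f f') (hg : EssRestr g g') :
    EssRestr (f.comp g) (f'.comp g') := by
  rw [essRestr_iff] at hf hg ⊢
  refine ⟨fun x y h => ?_, ?_⟩
  · obtain ⟨w, hw, hy⟩ := comp_eq_some.1 h
    exact comp_eq_some.2 ⟨w, hg.1 _ _ hw, hf.1 _ _ hy⟩
  · rintro x ⟨y, hy⟩
    obtain ⟨w, hw, hy⟩ := comp_eq_some.1 hy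
    obtain ⟨v, r, hv⟩ := hg.2 x ⟨w, hw⟩
    have e := hg.1 _ _ hv
    rw [g'.map_append _ _ v hw] at e
    obtain rfl := Option.some.inj e
    obtain ⟨t, s, ht⟩ := hf.2 (w ++ v) ⟨_, f'.map_append _ _ v hy⟩
    refine ⟨v ++ t, s, comp_eq_some.2 ⟨w ++ v ++ t, ?_, ht⟩⟩
    rw [← List.append_assoc]
    exact g.map_append _ _ t hv

end RIHom

/-! ## The Thompson-Higman monoid `M_{2,1}` -/

/-- The elements of `M_{2,1}`: maximal right-ideal homomorphisms. -/
def M21 : Type := {f : RIHom // f.IsMax}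

namespace M21

/-- The partial action on words. -/
def act (a : M21) (x : Word) : Option Word := a.1.toFun x

/-- The element of `M_{2,1}` represented by a right-ideal homomorphism. -/
noncomputable def ofHom (f : RIHom) : M21 := ⟨f.maxExt, f.maxExt_isMax⟩

theorem ofHom_eq_of_essRestr {f g : RIHom} (h : f.EssRestr g) : ofHom f = ofHom g :=
  Subtype.ext h.maxExt_eq

theorem ofHom_val (a : M21) : ofHom a.1 = a := Subtype.ext a.2.maxExt_eq

/-- Multiplication is composition followed by maximum essential extension. -/
noncomputable instance : Monoid M21 where
  one := ⟨RIHom.id, RIHom.id_isMax⟩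
  mul a b := ofHom (a.1.comp b.1)
  mul_assoc a b c := by
    have h1 : ofHom ((ofHom (a.1.comp b.1)).1.comp c.1) = ofHom ((a.1.comp b.1).comp c.1) :=
      (ofHom_eq_of_essRestr ((a.1.comp b.1).essRestr_maxExt.comp c.1.essRestr_refl)).symm
    have h2 : ofHom (a.1.comp (ofHom (b.1.comp c.1)).1) = ofHom (a.1.comp (b.1.comp c.1)) :=
      (ofHom_eq_of_essRestr (a.1.essRestr_refl.comp (b.1.comp c.1).essRestr_maxExt)).symm
    exact h1.trans ((congrArg ofHom (RIHom.comp_assoc _ _ _)).trans h2.symm)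
  one_mul a := (congrArg ofHom (RIHom.id_comp a.1)).trans (ofHom_val a)
  mul_one a := (congrArg ofHom (RIHom.comp_id a.1)).trans (ofHom_val a)

theorem one_val : (1 : M21).1 = RIHom.id := rfl

theorem mul_def (a b : M21) : a * b = ofHom (a.1.comp b.1) := rfl

theorem ofHom_mul (f g : RIHom) : ofHom f * ofHom g = ofHom (f.comp g) :=
  (ofHom_eq_of_essRestr (f.essRestr_maxExt.comp g.essRestr_maxExt)).symm

end M21

/-- The submonoid `lepM_{2,1}` (as a set): the elements of `M_{2,1}` represented by a
length-equality preserving right-ideal homomorphism `P A* → Q A*`, where `P`, `Q` are finite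
prefix codes and `P` is maximal. -/
def lepM21 : Set M21 :=
  {a | ∃ (f : RIHom) (P Q : Set Word), P.Finite ∧ Q.Finite ∧
    IsMaximalPrefixCode P ∧ IsPrefixCode Q ∧ f.dom = genIdeal P ∧ f.im = genIdeal Q ∧
    (∀ x₁ x₂ y₁ y₂ : Word, f.toFun x₁ = some y₁ → f.toFun x₂ = some y₂ →
      x₁.length = x₂.length → y₁.length = y₂.length) ∧
    M21.ofHom f = a}

/-! ## The Thompson group `G_{2,1}` -/

/-- The Thompson group `G_{2,1}`, as the group of invertible elements of `M_{2,1}`; these are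
exactly the maximally extended isomorphisms between finitely generated essential right ideals,
see `isUnit_iff`. -/
abbrev G21 : Type := M21ˣ

theorem act_mul_of_act {a b : M21} {x y z : Word} (hb : b.act x = some y)
    (ha : a.act y = some z) : (a * b).act x = some z :=
  (RIHom.essRestr_maxExt (a.1.comp b.1)).1 _ _ (RIHom.comp_eq_some.2 ⟨y, hb, ha⟩)

/-- The inverse partial function of an injective right-ideal homomorphism. -/
theorem exists_inverse (f : RIHom)
    (hinj : ∀ x x' y, f.toFun x = some y → f.toFun x' = some y → x = x') :
    ∃ g : RIHom, ∀ x y, g.toFun y = some x ↔ f.toFun x = some y := by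
  classical
  have key : ∀ x y, (if h : ∃ x, f.toFun x = some y then some h.choose else none) = some x ↔
      f.toFun x = some y := by
    intro x y
    split_ifs with h
    · constructor
      · intro e
        rw [← Option.some.inj e]
        exact h.choose_spec
      · intro e
        rw [hinj _ _ _ h.choose_spec e]
    · constructor
      · intro e; cases e
      · intro e; exact absurd ⟨x, e⟩ h
  obtain ⟨P, hP, hdom⟩ := f.fg
  rw [RIHom.isSome_set_eq] at hdom
  refine ⟨⟨fun y => if h : ∃ x, f.toFun x = some y then some h.choose else none, ?_, ?_⟩, key⟩
  · intro y x z h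
    exact (key _ _).2 (f.map_append _ _ z ((key _ _).1 h))
  · refine ⟨(fun p => (f.toFun p).getD []) '' P, hP.image _, ?_⟩
    ext y
    constructor
    · intro hy
      obtain ⟨x, hx⟩ := Option.isSome_iff_exists.1 hy
      replace hx := (key _ _).1 hx
      have hxd : x ∈ f.dom := ⟨y, hx⟩
      rw [hdom] at hxd
      obtain ⟨p, hp, z, rfl⟩ := hxd
      have hpd : p ∈ f.dom := by rw [hdom]; exact ⟨p, hp, List.prefix_refl p⟩
      obtain ⟨q, hq⟩ := hpd
      rw [f.map_append _ _ z hq] at hx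
      refine ⟨q, ⟨p, hp, by simp [hq]⟩, z, Option.some.inj hx⟩
    · rintro ⟨q, ⟨p, hp, rfl⟩, z, rfl⟩
      have hpd : p ∈ f.dom := by rw [hdom]; exact ⟨p, hp, List.prefix_refl p⟩
      obtain ⟨q, hq⟩ := hpd
      refine Option.isSome_iff_exists.2 ⟨p ++ z, (key _ _).2 ?_⟩
      change f.toFun (p ++ z) = some ((f.toFun p).getD [] ++ z)
      rw [hq]
      exact f.map_append _ _ z hq

theorem exists_append_of_mul_eq_one {a b : M21} (h : a * b = 1) (x : Word) :
    ∃ v y, b.act (x ++ v) = some y ∧ a.act y = some (x ++ v) := by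
  have hr := RIHom.essRestr_maxExt (a.1.comp b.1)
  have h' : (a.1.comp b.1).maxExt = RIHom.id := congrArg Subtype.val h
  rw [h', RIHom.essRestr_iff] at hr
  obtain ⟨v, z, hv⟩ := hr.2 x ⟨x, rfl⟩
  have e : x ++ v = z := Option.some.inj (hr.1 _ _ hv)
  subst e
  obtain ⟨y, hy, hz⟩ := RIHom.comp_eq_some.1 hv
  exact ⟨v, y, hy, hz⟩

/-- The invertible elements of `M_{2,1}` are the maximal isomorphisms between essential right
ideals. -/
theorem isUnit_iff (a : M21) : IsUnit a ↔
    (∀ x x' y, a.act x = some y → a.act x' = some y → x = x') ∧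
      Essential a.1.dom ∧ Essential a.1.im := by
  constructor
  · rintro ⟨u, rfl⟩
    refine ⟨fun x x' y h h' => ?_, fun I hI hne => ?_, fun I hI hne => ?_⟩
    · obtain ⟨v, t, hv, ht⟩ := exists_append_of_mul_eq_one (u.inv_mul) x
      obtain ⟨v', t', hv', ht'⟩ := exists_append_of_mul_eq_one (u.inv_mul) (x' ++ v)
      have e1 := (u : M21).1.map_append _ _ v h
      have e1' := (u : M21).1.map_append _ _ (v ++ v') h'
      have e2 : t = y ++ v := Option.some.inj (hv.symm.trans e1)
      rw [List.append_assoc] at hv'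
      have e2' : t' = y ++ (v ++ v') := Option.some.inj (hv'.symm.trans e1')
      subst e2 e2'
      have e3 := (↑u⁻¹ : M21).1.map_append _ _ v' ht
      rw [List.append_assoc] at e3
      have e4 := Option.some.inj (e3.symm.trans ht')
      exact List.append_cancel_right (List.append_cancel_right e4)
    · obtain ⟨x, hx⟩ := hne
      obtain ⟨v, y, hv, -⟩ := exists_append_of_mul_eq_one (u.inv_mul) x
      exact ⟨x ++ v, ⟨y, hv⟩, hI x hx v⟩
    · obtain ⟨x, hx⟩ := hne
      obtain ⟨v, y, -, hv⟩ := exists_append_of_mul_eq_one (u.mul_inv) x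
      exact ⟨x ++ v, ⟨y, hv⟩, hI x hx v⟩
  · rintro ⟨hinj, hd, hi⟩
    obtain ⟨g, hg⟩ := exists_inverse a.1 hinj
    have ess : ∀ {R : Set Word}, Essential R → ∀ x, ∃ v, x ++ v ∈ R := by
      intro R hR x
      obtain ⟨w, hw, v, rfl⟩ := hR {w | x <+: w}
        (fun w hw z => List.IsPrefix.trans hw (List.prefix_append _ _)) ⟨x, List.prefix_refl x⟩
      exact ⟨v, hw⟩
    have hone : ∀ f : RIHom, f.EssRestr RIHom.id → M21.ofHom f = 1 := fun f hf =>
      (M21.ofHom_eq_of_essRestr hf).trans (M21.ofHom_val 1)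
    refine ⟨⟨a, M21.ofHom g, ?_, ?_⟩, rfl⟩
    · rw [← M21.ofHom_val a, M21.ofHom_mul]
      refine hone _ ((RIHom.essRestr_iff _ _).2 ⟨fun x y h => ?_, fun x _ => ?_⟩)
      · obtain ⟨w, hw, hy⟩ := RIHom.comp_eq_some.1 h
        exact ((hg _ _).1 hw).symm.trans hy
      · obtain ⟨v, w, hv⟩ := ess hi x
        exact ⟨v, x ++ v, RIHom.comp_eq_some.2 ⟨w, (hg _ _).2 hv, hv⟩⟩
    · rw [← M21.ofHom_val a, M21.ofHom_mul]
      refine hone _ ((RIHom.essRestr_iff _ _).2 ⟨fun x y h => ?_, fun x _ => ?_⟩)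
      · obtain ⟨w, hw, hy⟩ := RIHom.comp_eq_some.1 h
        rw [show RIHom.id.toFun x = some x from rfl, hinj _ _ _ hw ((hg _ _).1 hy)]
      · obtain ⟨v, w, hv⟩ := ess hd x
        exact ⟨v, x ++ v, RIHom.comp_eq_some.2 ⟨w, hv, (hg _ _).2 hv⟩⟩

/-- The subgroup `lpG_{2,1}` of length-preserving elements of `G_{2,1}` (as a set). -/
def lpG21 : Set G21 :=
  {g | ∀ x y, (g : M21).act x = some y → y.length = x.length}

/-! ## Position transpositions -/

/-- Exchange the letters at the positions `i < j` (counted from `0`) of a word. -/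
def swapWord (i j : ℕ) (x : Word) : Word :=
  (x.set i (x.getD j false)).set j (x.getD i false)

/-- The position transposition, defined on the words long enough to have a letter at `j`. -/
def tauHom (i j : ℕ) (hij : i < j) : RIHom where
  toFun x := if j < x.length then some (swapWord i j x) else none
  map_append x y z h := by
    split_ifs at h with hj
    rw [← Option.some.inj h, if_pos (by rw [List.length_append]; omega)]
    have hi : i < x.length := hij.trans hj
    simp only [swapWord]
    rw [List.getD_append _ _ _ _ hj, List.getD_append _ _ _ _ hi, List.set_append_left _ _ hi,
      List.set_append_left _ _ (by simpa using hj)]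
  fg := by
    refine ⟨{p | p.length = j + 1}, List.finite_length_eq Bool (j + 1), ?_⟩
    ext x
    constructor
    · intro hx
      have hj : j < x.length := by
        by_contra hj
        simp [hj] at hx
      exact ⟨x.take (j + 1), by simp only [Set.mem_ofPred_eq, List.length_take]; omega,
        List.take_prefix _ _⟩
    · rintro ⟨p, hp, hpx⟩
      have := hpx.length_le
      simp only [Set.mem_ofPred_eq] at hp ⊢
      rw [if_pos (by omega)]
      rfl

/-- The set `τ` of all position transpositions in `M_{2,1}`. -/
def tauM : Set M21 := {a | ∃ (i j : ℕ) (hij : i < j), a = M21.ofHom (tauHom i j hij)}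

theorem swapWord_swapWord {i j : ℕ} (hij : i < j) {x : Word} (hj : j < x.length) :
    swapWord i j (swapWord i j x) = x := by
  have hi : i < x.length := hij.trans hj
  apply List.ext_getElem
  · simp [swapWord]
  · intro k h1 h2
    simp only [swapWord, List.getElem_set, List.getD_eq_getElem?_getD, List.getElem?_set,
      List.length_set]
    grind

theorem tau_mul_self (i j : ℕ) (hij : i < j) :
    M21.ofHom (tauHom i j hij) * M21.ofHom (tauHom i j hij) = 1 := by
  rw [M21.ofHom_mul]
  refine (M21.ofHom_eq_of_essRestr (g := RIHom.id) ?_).trans (M21.ofHom_val 1)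
  have hlen : ∀ x : Word, (swapWord i j x).length = x.length := fun x => by simp [swapWord]
  rw [RIHom.essRestr_iff]
  refine ⟨fun x y h => ?_, fun x _ => ⟨List.replicate (j + 1) false,
    x ++ List.replicate (j + 1) false, ?_⟩⟩
  · obtain ⟨w, hw, hy⟩ := RIHom.comp_eq_some.1 h
    simp only [tauHom, Option.ite_none_right_eq_some, Option.some.injEq] at hw hy
    obtain ⟨hj, rfl⟩ := hw
    obtain ⟨-, rfl⟩ := hy
    rw [swapWord_swapWord hij hj]
    rfl
  · have hj : j < (x ++ List.replicate (j + 1) false).length := by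
      rw [List.length_append, List.length_replicate]; omega
    refine RIHom.comp_eq_some.2 ⟨swapWord i j (x ++ List.replicate (j + 1) false), ?_, ?_⟩
    · exact if_pos hj
    · refine (if_pos (by rwa [hlen])).trans ?_
      rw [swapWord_swapWord hij hj]

/-- The set `τ` of all position transpositions in `G_{2,1}` (each of them is invertible, by
`tau_mul_self`). -/
def tauG : Set G21 := {g | (g : M21) ∈ tauM}

/-! ## The embedding `g ↦ (g)_0` and the fixator of `0 A*` -/

/-- `0 x ↦ 0 f(x)` and `1 x ↦ 1 x`. -/
def lift0Hom (f : RIHom) : RIHom where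
  toFun
    | [] => none
    | false :: x => (f.toFun x).map (List.cons false)
    | true :: x => some (true :: x)
  map_append x y z h := by
    match x, h with
    | false :: x, h =>
      obtain ⟨w, hw, rfl⟩ := Option.map_eq_some_iff.1 h
      exact Option.map_eq_some_iff.2 ⟨_, f.map_append _ _ z hw, rfl⟩
    | true :: x, h =>
      obtain rfl := Option.some.inj h
      rfl
  fg := by
    obtain ⟨P, hP, hdom⟩ := f.fg
    refine ⟨insert [true] (List.cons false '' P), (hP.image _).insert _, ?_⟩
    ext x
    match x with
    | [] => simp [genIdeal]
    | true :: x => simp [genIdeal]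
    | false :: x =>
      have := congrArg (x ∈ ·) hdom
      simpa [genIdeal] using this

theorem lift0Hom_false (f : RIHom) (x : Word) :
    (lift0Hom f).toFun (false :: x) = (f.toFun x).map (List.cons false) := rfl

theorem lift0Hom_true (f : RIHom) (x : Word) :
    (lift0Hom f).toFun (true :: x) = some (true :: x) := rfl

theorem lift0Hom_essRestr {f g : RIHom} (h : f.EssRestr g) :
    (lift0Hom f).EssRestr (lift0Hom g) := by
  rw [RIHom.essRestr_iff] at h ⊢
  refine ⟨fun x y hxy => ?_, fun x hx => ?_⟩
  · match x, hxy with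
    | false :: x, hxy =>
      obtain ⟨w, hw, rfl⟩ := Option.map_eq_some_iff.1 hxy
      exact Option.map_eq_some_iff.2 ⟨_, h.1 _ _ hw, rfl⟩
    | true :: x, hxy => exact hxy
  · match x, hx with
    | false :: x, hx =>
      obtain ⟨y, hy⟩ := hx
      obtain ⟨w, hw, rfl⟩ := Option.map_eq_some_iff.1 hy
      obtain ⟨v, r, hr⟩ := h.2 x ⟨w, hw⟩
      exact ⟨v, false :: r, Option.map_eq_some_iff.2 ⟨_, hr, rfl⟩⟩
    | true :: x, _ => exact ⟨[], true :: x, by rw [List.append_nil]; rfl⟩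

theorem lift0Hom_comp (f g : RIHom) :
    lift0Hom (f.comp g) = (lift0Hom f).comp (lift0Hom g) := by
  ext x : 2
  match x with
  | [] => rfl
  | true :: x => rfl
  | false :: x =>
    change ((g.toFun x).bind f.toFun).map _ = ((g.toFun x).map _).bind _
    cases g.toFun x <;> rfl

/-- `φ ↦ (φ)_0` on `M_{2,1}`. -/
noncomputable def lift0M : M21 →* M21 where
  toFun a := M21.ofHom (lift0Hom a.1)
  map_one' := by
    refine (M21.ofHom_eq_of_essRestr (g := RIHom.id) ?_).trans (M21.ofHom_val 1)
    rw [RIHom.essRestr_iff]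
    refine ⟨fun x y hxy => ?_, fun x _ => ?_⟩
    · match x, hxy with
      | false :: x, hxy => exact hxy
      | true :: x, hxy => exact hxy
    · exact ⟨[true], match x with
        | [] => ⟨_, rfl⟩
        | false :: x => ⟨_, rfl⟩
        | true :: x => ⟨_, rfl⟩⟩
  map_mul' a b := by
    rw [M21.ofHom_mul, ← lift0Hom_comp]
    exact (M21.ofHom_eq_of_essRestr (lift0Hom_essRestr (a.1.comp b.1).essRestr_maxExt)).symm

/-- The embedding `g ↦ (g)_0` of `G_{2,1}` into itself. -/
noncomputable def lift0 : G21 →* G21 := Units.map lift0M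

theorem act_inv_of_act {g : G21} {x : Word} (h : (g : M21).act x = some x) :
    (↑g⁻¹ : M21).act x = some x := by
  have hm := (↑g⁻¹ : M21).2.maxExt_eq
  change (↑g⁻¹ : M21).1.toFun x = some x
  rw [← hm]
  refine RIHom.maxExt_eq_some.2 ⟨fun u => ?_, fun z w hw => ?_⟩
  · obtain ⟨v, y, hv, hy⟩ := exists_append_of_mul_eq_one g.inv_mul (x ++ u)
    refine ⟨v, x ++ u ++ v, ?_⟩
    have e := (g : M21).1.map_append _ _ (u ++ v) h
    rw [← List.append_assoc] at e
    have e2 : y = x ++ u ++ v := Option.some.inj (hv.symm.trans e)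
    rwa [e2] at hy
  · have h1 : ((↑g⁻¹ : M21) * g).act (x ++ z) = some w :=
      act_mul_of_act ((g : M21).1.map_append _ _ z h) hw
    rw [g.inv_mul] at h1
    exact (Option.some.inj h1).symm

/-- The fixator `Fix(0)` of `0 A*` in `G_{2,1}`. -/
def fix0 : Subgroup G21 where
  carrier := {g | ∀ x : Word, (g : M21).act (false :: x) = some (false :: x)}
  one_mem' _ := rfl
  mul_mem' ha hb x := act_mul_of_act (hb x) (ha x)
  inv_mem' ha x := act_inv_of_act (ha x)

/-! ## Word-length, Schreier graph distance, distortion -/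

/-- The word-length of `x` over the set `S`: the minimum length of a word over `S` that
represents `x` (`⊤` if there is none). -/
noncomputable def wordLength {M : Type*} [Monoid M] (S : Set M) (x : M) : ℕ∞ :=
  ⨅ (w : List M) (_ : (∀ s ∈ w, s ∈ S) ∧ w.prod = x), (w.length : ℕ∞)

/-- The directed distance in a directed graph: the minimum length of a directed path from
`u` to `v` (`⊤` if there is none). -/
noncomputable def pathDist {V : Type*} (E : V → V → Prop) (u v : V) : ℕ∞ :=
  ⨅ (n : ℕ) (_ : ∃ p : ℕ → V, p 0 = u ∧ p n = v ∧ ∀ i < n, E (p i) (p (i + 1))), (n : ℕ∞)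

/-- The edges `h F → γ h F`, `γ ∈ S`, of the Schreier left coset graph of `F` in `H`. -/
def schreierEdge {H : Type*} [Group H] (F : Subgroup H) (S : Set H) (u v : H ⧸ F) : Prop :=
  ∃ γ ∈ S, ∃ h : H, u = QuotientGroup.mk h ∧ v = QuotientGroup.mk (γ * h)

/-- The distance on `G_{2,1}` inherited, along `g ↦ (g)_0 Fix(0)`, from the Schreier graph of
`G_{2,1} / Fix(0)` over `S`. -/
noncomputable def schreierDist (S : Set G21) (g g' : G21) : ℕ∞ :=
  pathDist (schreierEdge fix0 S) (lift0 g : G21 ⧸ fix0) (lift0 g' : G21 ⧸ fix0)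

/-- The distortion of `lpG_{2,1}` that compares the Schreier graph distance from `1` over `S`
with the word-length over `T ⊆ M_{2,1}`:
`n ↦ max {D(1,g) : g ∈ lpG_{2,1}, |g|_T ≤ n}`. -/
noncomputable def distortion (S : Set G21) (T : Set M21) (n : ℕ) : ℕ∞ :=
  ⨆ (g : G21) (_ : g ∈ lpG21 ∧ wordLength T (g : M21) ≤ n), schreierDist S 1 g

/-- Polynomial equivalence of two functions. -/
def PolyEquiv (f₁ f₂ : ℕ → ℕ∞) : Prop :=
  ∃ c₀ c₁ c₂ d e : ℕ, 0 < c₀ ∧ 0 < c₁ ∧ 0 < c₂ ∧ 0 < d ∧ 0 < e ∧ ∀ n ≥ c₀,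
    f₁ n ≤ c₁ * f₂ (c₁ * n ^ d) ^ d ∧ f₂ n ≤ c₂ * f₁ (c₂ * n ^ e) ^ e

end Thompson

/-!
An element of `M_{2,1}` is determined by its action on infinite sequences together with the changes
of length. A generator whose change of length depends on its argument is not in `lepM_{2,1}`, but it
becomes length-preserving if the sequence is preceded by free cells and by an array of flags that
records in unary how many of the cells are free. A generator is then simulated by trying, for each
flag, a gate that acts on a window of bounded size if the flag is set. Gates on windows at different
positions are conjugate by boundedly many position transpositions, so that a gate has bounded
word-length in `lepM_{2,1}`. For a product of `n` generators `O(n)` flags suffice, hence each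
generator costs `O(n)`, and the product costs `O(n²)`. Creating and removing the flags and cells
around the simulation is possible in `lepM_{2,1}` when the product preserves lengths.

`Δ(n)` is finite because an element of `lpG_{2,1}` of length `n` over `Γ_{lepM} ∪ τ` rewrites only
`O(n)` letters. Permuting positions, which costs `O(n)` because `τ_{i,j}` has bounded Schreier
distance, moves these letters to the front, and only finitely many such elements remain.
-/

namespace Thompson

open scoped Pointwise

theorem iInf₂_natCast_le_iff {ι : Type*} {P : ι → Prop} {f : ι → ℕ} {n : ℕ} :
    ⨅ (i) (_ : P i), (f i : ℕ∞) ≤ n ↔ ∃ i, P i ∧ f i ≤ n := by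
  rw [← ENat.lt_add_one_iff (ENat.natCast_ne_top n)]
  simp only [iInf_lt_iff, exists_prop]
  norm_cast
  simp only [Nat.lt_succ_iff]

section WordBall

variable {M : Type*} [Monoid M] {S S' T : Set M} {m n : ℕ} {x y : M}

/-- The elements of word-length at most `n` over `S`. -/
def wordBall (S : Set M) (n : ℕ) : Set M := {x | wordLength S x ≤ n}

theorem mem_wordBall_iff : x ∈ wordBall S n ↔ ∃ m ≤ n, x ∈ S ^ m := by
  refine iInf₂_natCast_le_iff.trans ?_
  constructor
  · rintro ⟨w, ⟨hw, rfl⟩, hn⟩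
    exact ⟨w.length, hn, Set.mem_pow.2 ⟨fun i => ⟨w[i], hw _ (List.getElem_mem _)⟩, by simp⟩⟩
  · rintro ⟨m, hm, hx⟩
    obtain ⟨f, rfl⟩ := Set.mem_pow.1 hx
    refine ⟨List.ofFn fun i => (f i : M), ⟨fun s hs => ?_, rfl⟩, by simpa using hm⟩
    obtain ⟨i, rfl⟩ := List.mem_ofFn.1 hs
    exact (f i).2

theorem wordBall_mono (h : m ≤ n) : wordBall S m ⊆ wordBall S n :=
  fun _ hx => le_trans (b := (m : ℕ∞)) hx (by exact_mod_cast h)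

theorem one_mem_wordBall : 1 ∈ wordBall S n := mem_wordBall_iff.2 ⟨0, n.zero_le, by simp⟩

theorem subset_wordBall_one : S ⊆ wordBall S 1 :=
  fun _ hx => mem_wordBall_iff.2 ⟨1, le_rfl, by simpa using hx⟩

theorem mul_mem_wordBall (hx : x ∈ wordBall S m) (hy : y ∈ wordBall S n) :
    x * y ∈ wordBall S (m + n) := by
  obtain ⟨k, hk, hx⟩ := mem_wordBall_iff.1 hx
  obtain ⟨l, hl, hy⟩ := mem_wordBall_iff.1 hy
  exact mem_wordBall_iff.2 ⟨k + l, by omega, pow_add S k l ▸ Set.mul_mem_mul hx hy⟩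

theorem pow_subset_wordBall (h : S ⊆ wordBall S' n) (m : ℕ) : S ^ m ⊆ wordBall S' (m * n) := by
  induction m with
  | zero => simpa using one_mem_wordBall
  | succ m ih =>
    rw [pow_succ, add_mul, one_mul]
    rintro _ ⟨x, hx, y, hy, rfl⟩
    exact mul_mem_wordBall (ih hx) (h hy)

theorem pow_mem_wordBall (hx : x ∈ wordBall S n) (m : ℕ) : x ^ m ∈ wordBall S (m * n) :=
  pow_subset_wordBall (Set.singleton_subset_iff.2 hx) m (Set.pow_mem_pow rfl)

theorem wordBall_subset_wordBall (h : S ⊆ wordBall S' n) :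
    wordBall S m ⊆ wordBall S' (m * n) := by
  intro x hx
  obtain ⟨k, hk, hx⟩ := mem_wordBall_iff.1 hx
  exact wordBall_mono (Nat.mul_le_mul_right n hk) (pow_subset_wordBall h k hx)

theorem exists_mem_wordBall (hx : x ∈ Submonoid.closure S) : ∃ n, x ∈ wordBall S n := by
  induction hx using Submonoid.closure_induction with
  | mem x hx => exact ⟨1, subset_wordBall_one hx⟩
  | one => exact ⟨0, one_mem_wordBall⟩
  | mul x y _ _ hx hy =>
    obtain ⟨m, hm⟩ := hx
    obtain ⟨n, hn⟩ := hy
    exact ⟨m + n, mul_mem_wordBall hm hn⟩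

theorem exists_subset_wordBall (hT : T.Finite) (h : T ⊆ Submonoid.closure S) :
    ∃ n, T ⊆ wordBall S n := by
  choose! N hN using fun x (hx : x ∈ T) => exists_mem_wordBall (h hx)
  obtain ⟨n, hn⟩ := (hT.image N).bddAbove
  exact ⟨n, fun x hx => wordBall_mono (hn ⟨x, hx, rfl⟩) (hN x hx)⟩

theorem inv_mem_wordBall {G : Type*} [Group G] {S : Set G} {n : ℕ} {x : G}
    (hS : ∀ s ∈ S, s⁻¹ ∈ S) (hx : x ∈ wordBall S n) : x⁻¹ ∈ wordBall S n := by
  obtain ⟨m, hm, hx⟩ := mem_wordBall_iff.1 hx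
  have hSS : S⁻¹ = S := Set.Subset.antisymm (fun s hs => inv_inv s ▸ hS _ hs) hS
  refine mem_wordBall_iff.2 ⟨m, hm, ?_⟩
  rw [← hSS, inv_pow]
  exact Set.inv_mem_inv.2 hx

theorem map_mem_wordBall {M N : Type*} [Monoid M] [Monoid N] {S : Set M} {S' : Set N} {n : ℕ}
    {x : M} (f : M →* N) (hf : Set.MapsTo f S S') (hx : x ∈ wordBall S n) :
    f x ∈ wordBall S' n := by
  obtain ⟨m, hm, hx⟩ := mem_wordBall_iff.1 hx
  refine mem_wordBall_iff.2 ⟨m, hm, ?_⟩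
  exact Set.pow_subset_pow_left hf.image_subset (Set.image_pow f S m ▸ Set.mem_image_of_mem f hx)

end WordBall

/-! ### Infinite sequences -/

theorem take_append_stream {α : Type*} (x : List α) (r : Stream' α) :
    (x ++ₛ r).take x.length = x := by
  rw [Stream'.take_append_of_le_length _ _ _ le_rfl, List.take_length]

theorem get_append_stream_of_length_le {α : Type*} {x : List α} (r : Stream' α) {n : ℕ}
    (h : x.length ≤ n) : (x ++ₛ r).get n = r.get (n - x.length) := by
  obtain ⟨n, rfl⟩ := Nat.exists_eq_add_of_le h
  rw [Stream'.get_append_right, Nat.add_sub_cancel_left]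

theorem exists_append_of_append_stream_eq {α : Type*} {x y : List α} {r r' : Stream' α}
    (h : x ++ₛ r = y ++ₛ r') (hl : x.length ≤ y.length) : ∃ v, y = x ++ v ∧ r = v ++ₛ r' := by
  have hx : x = y.take x.length := by
    rw [← Stream'.take_append_of_le_length _ y r' hl, ← h, take_append_stream]
  obtain ⟨v, rfl⟩ : x <+: y := List.prefix_iff_eq_take.2 hx
  refine ⟨v, rfl, ?_⟩
  rw [Stream'.append_append_stream] at h
  exact Stream'.append_right_injective _ _ _ h

namespace RIHom

/-- `f.Maps s d t`: the action of `f` on infinite sequences takes `s` to `t`, where a prefix of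
`s` is replaced by a prefix of `t` that is longer by `d`. -/
def Maps (f : RIHom) (s : Stream' Bool) (d : ℤ) (t : Stream' Bool) : Prop :=
  ∃ x y r, f.toFun x = some y ∧ s = x ++ₛ r ∧ t = y ++ₛ r ∧ (y.length : ℤ) = x.length + d

theorem maps_append {f : RIHom} {x y : Word} (h : f.toFun x = some y) (r : Stream' Bool) :
    f.Maps (x ++ₛ r) ((y.length : ℤ) - x.length) (y ++ₛ r) :=
  ⟨x, y, r, h, rfl, rfl, by ring⟩

theorem Maps.exists_le_length {f : RIHom} {s t : Stream' Bool} {d : ℤ} (h : f.Maps s d t)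
    (m : ℕ) : ∃ x y r, m ≤ x.length ∧ f.toFun x = some y ∧ s = x ++ₛ r ∧ t = y ++ₛ r ∧
      (y.length : ℤ) = x.length + d := by
  obtain ⟨x, y, r, hxy, rfl, rfl, hd⟩ := h
  refine ⟨x ++ r.take m, y ++ r.take m, r.drop m, by simp, f.map_append _ _ _ hxy, ?_, ?_, ?_⟩
  · rw [Stream'.append_append_stream, Stream'.append_take_drop]
  · rw [Stream'.append_append_stream, Stream'.append_take_drop]
  · simp only [List.length_append, Stream'.length_take]
    omega

theorem Maps.unique {f : RIHom} {s t t' : Stream' Bool} {d d' : ℤ} (h : f.Maps s d t)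
    (h' : f.Maps s d' t') : d = d' ∧ t = t' := by
  obtain ⟨x, y, r, hxy, rfl, rfl, hd⟩ := h
  obtain ⟨x', y', r', hl, hxy', he, rfl, hd'⟩ := h'.exists_le_length x.length
  obtain ⟨v, rfl, rfl⟩ := exists_append_of_append_stream_eq he hl
  obtain rfl := Option.some.inj ((f.map_append _ _ v hxy).symm.trans hxy')
  refine ⟨?_, (Stream'.append_append_stream _ _ _).symm⟩
  simp only [List.length_append, Nat.cast_add] at hd'
  omega

theorem comp_maps {f g : RIHom} {s t : Stream' Bool} {d : ℤ} : (f.comp g).Maps s d t ↔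
    ∃ d₁ u d₂, g.Maps s d₁ u ∧ f.Maps u d₂ t ∧ d = d₁ + d₂ := by
  constructor
  · rintro ⟨x, y, r, hxy, rfl, rfl, hd⟩
    obtain ⟨w, hw, hy⟩ := comp_eq_some.1 hxy
    exact ⟨_, _, _, maps_append hw r, maps_append hy r, by omega⟩
  · rintro ⟨d₁, u, d₂, ⟨x, y, r, hxy, rfl, rfl, hd⟩, h, rfl⟩
    obtain ⟨x', y', r', hl, hxy', he, rfl, hd'⟩ := h.exists_le_length y.length
    obtain ⟨v, rfl, rfl⟩ := exists_append_of_append_stream_eq he hl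
    refine ⟨x ++ v, y', r', comp_eq_some.2 ⟨_, g.map_append _ _ v hxy, hxy'⟩,
      (Stream'.append_append_stream _ _ _).symm, rfl, ?_⟩
    simp only [List.length_append, Nat.cast_add] at hd' ⊢
    omega

theorem exists_toFun_eq_of_le_length (f : RIHom) :
    ∃ m, ∀ x y, m ≤ x.length → f.maxExt.toFun x = some y → f.toFun x = some y := by
  obtain ⟨P, hP, hdom⟩ := f.fg
  rw [isSome_set_eq] at hdom
  obtain ⟨m, hm⟩ := (hP.image List.length).bddAbove
  refine ⟨m, fun x y hl hxy => ?_⟩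
  rw [maxExt_eq_some] at hxy
  obtain ⟨v, hv⟩ := hxy.1 []
  rw [List.append_nil, hdom] at hv
  obtain ⟨p, hp, hpxv⟩ := hv
  have hpx : p <+: x :=
    List.prefix_of_prefix_length_le hpxv (List.prefix_append _ _) ((hm ⟨p, hp, rfl⟩).trans hl)
  obtain ⟨w, hw⟩ : x ∈ f.dom := hdom ▸ ⟨p, hp, hpx⟩
  have hwy := hxy.2 [] w (by simpa using hw)
  rwa [hwy, List.append_nil] at hw

theorem maxExt_maps {f : RIHom} {s t : Stream' Bool} {d : ℤ} :
    f.maxExt.Maps s d t ↔ f.Maps s d t := by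
  constructor
  · intro h
    obtain ⟨m, hm⟩ := f.exists_toFun_eq_of_le_length
    obtain ⟨x, y, r, hl, hxy, h⟩ := h.exists_le_length m
    exact ⟨x, y, r, hm x y hl hxy, h⟩
  · rintro ⟨x, y, r, hxy, h⟩
    exact ⟨x, y, r, maxExt_eq_some.2 (maxVal_of_eq hxy), h⟩

end RIHom

namespace M21

/-- The action of `M_{2,1}` on infinite sequences: `a.Maps s d t` if `a` takes `s` to `t` and
replaces a prefix of `s` by one that is longer by `d`. -/
def Maps (a : M21) (s : Stream' Bool) (d : ℤ) (t : Stream' Bool) : Prop := a.1.Maps s d t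

theorem ofHom_maps {f : RIHom} {s t : Stream' Bool} {d : ℤ} :
    (ofHom f).Maps s d t ↔ f.Maps s d t := RIHom.maxExt_maps

theorem mul_maps {a b : M21} {s t : Stream' Bool} {d : ℤ} : (a * b).Maps s d t ↔
    ∃ d₁ u d₂, b.Maps s d₁ u ∧ a.Maps u d₂ t ∧ d = d₁ + d₂ := by
  rw [mul_def, ofHom_maps, RIHom.comp_maps]
  rfl

theorem Maps.mul {a b : M21} {s t u : Stream' Bool} {d₁ d₂ : ℤ} (ha : a.Maps u d₂ t)
    (hb : b.Maps s d₁ u) : (a * b).Maps s (d₁ + d₂) t :=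
  mul_maps.2 ⟨d₁, u, d₂, hb, ha, rfl⟩

theorem Maps.mul_zero {a b : M21} {s t u : Stream' Bool} (ha : a.Maps u 0 t)
    (hb : b.Maps s 0 u) : (a * b).Maps s 0 t := by
  simpa using ha.mul hb

theorem Maps.unique {a : M21} {s t t' : Stream' Bool} {d d' : ℤ} (h : a.Maps s d t)
    (h' : a.Maps s d' t') : d = d' ∧ t = t' := RIHom.Maps.unique h h'

theorem one_maps (s : Stream' Bool) : (1 : M21).Maps s 0 s :=
  ⟨[], [], s, rfl, rfl, rfl, rfl⟩

theorem maps_of_act {a : M21} {x y : Word} (h : a.act x = some y) (r : Stream' Bool) :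
    a.Maps (x ++ₛ r) ((y.length : ℤ) - x.length) (y ++ₛ r) := RIHom.maps_append h r

theorem act_eq_some_iff {a : M21} {x y : Word} : a.act x = some y ↔
    ∀ r, a.Maps (x ++ₛ r) ((y.length : ℤ) - x.length) (y ++ₛ r) := by
  refine ⟨maps_of_act, fun h => ?_⟩
  change a.1.toFun x = some y
  rw [← a.2.maxExt_eq, RIHom.maxExt_eq_some]
  refine ⟨fun u => ?_, fun z w hw => ?_⟩
  · obtain ⟨x', y', r, hl, hxy, he, -, -⟩ :=
      (h (u ++ₛ Stream'.const false)).exists_le_length (x ++ u).length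
    rw [← Stream'.append_append_stream] at he
    obtain ⟨v, rfl, -⟩ := exists_append_of_append_stream_eq he hl
    exact ⟨v, _, hxy⟩
  · have hz := h (z ++ₛ Stream'.const false)
    rw [← Stream'.append_append_stream, ← Stream'.append_append_stream] at hz
    obtain ⟨hd, he⟩ := hz.unique (RIHom.maps_append hw (Stream'.const false))
    refine (Stream'.append_left_injective _ _ _ _ he ?_).symm
    simp only [List.length_append, Nat.cast_add] at hd ⊢
    omega

theorem ext_of_maps {a b : M21} (h : ∀ s d t, a.Maps s d t ↔ b.Maps s d t) : a = b :=
  Subtype.ext <| RIHom.ext_of_le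
    (fun _ _ hxy => act_eq_some_iff.2 fun r => (h _ _ _).1 (maps_of_act hxy r))
    (fun _ _ hxy => act_eq_some_iff.2 fun r => (h _ _ _).2 (maps_of_act hxy r))

theorem ext_of_exists_maps {a b : M21} (h : ∀ s, ∃ d t, a.Maps s d t ∧ b.Maps s d t) :
    a = b := by
  refine ext_of_maps fun s d t => ?_
  obtain ⟨d', t', ha, hb⟩ := h s
  constructor
  · intro h'
    obtain ⟨rfl, rfl⟩ := h'.unique ha
    exact hb
  · intro h'
    obtain ⟨rfl, rfl⟩ := h'.unique hb
    exact ha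

end M21

namespace G21

theorem maps_total (g : G21) (s : Stream' Bool) : ∃ d t, (g : M21).Maps s d t := by
  have h := M21.one_maps s
  rw [← g.inv_mul, M21.mul_maps] at h
  obtain ⟨d, t, -, h, -, -⟩ := h
  exact ⟨d, t, h⟩

theorem maps_inv {g : G21} {s t : Stream' Bool} {d : ℤ} (h : (g : M21).Maps s d t) :
    (↑g⁻¹ : M21).Maps t (-d) s := by
  have h1 := M21.one_maps s
  rw [← g.inv_mul, M21.mul_maps] at h1
  obtain ⟨d₁, u, d₂, hg, hinv, hd⟩ := h1
  obtain ⟨rfl, rfl⟩ := hg.unique h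
  rwa [show -d₁ = d₂ by omega]

theorem maps_inv_zero {g : G21} {s t : Stream' Bool} (h : (g : M21).Maps s 0 t) :
    (↑g⁻¹ : M21).Maps t 0 s := by
  simpa using maps_inv h

end G21

theorem mem_lpG21_iff {g : G21} : g ∈ lpG21 ↔ ∀ s d t, (g : M21).Maps s d t → d = 0 := by
  constructor
  · rintro h s d t ⟨x, y, r, hxy, -, -, hd⟩
    have := h x y hxy
    omega
  · intro h x y hxy
    have := h _ _ _ (M21.maps_of_act hxy (Stream'.const false))
    omega

/-- The right-ideal homomorphism that replaces the prefix `x` of length `k` by `φ x`. -/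
def prefixHom (k : ℕ) (φ : Word → Word) : RIHom where
  toFun x := if k ≤ x.length then some (φ (x.take k) ++ x.drop k) else none
  map_append x y z h := by
    split_ifs at h with hk
    rw [← Option.some.inj h, if_pos (by rw [List.length_append]; omega),
      List.take_append_of_le_length hk, List.drop_append_of_le_length hk, List.append_assoc]
  fg := by
    refine ⟨{p | p.length = k}, List.finite_length_eq Bool k, ?_⟩
    ext x
    constructor
    · intro hx
      have hk : k ≤ x.length := by
        by_contra hk
        simp [hk] at hx
      exact ⟨x.take k, by simpa using hk, List.take_prefix _ _⟩
    · rintro ⟨p, rfl, hpx⟩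
      exact Option.isSome_iff_exists.2 ⟨_, if_pos hpx.length_le⟩

theorem prefixHom_eq_some {k : ℕ} {φ : Word → Word} {x y : Word} :
    (prefixHom k φ).toFun x = some y ↔ k ≤ x.length ∧ φ (x.take k) ++ x.drop k = y := by
  simp [prefixHom]

theorem dom_prefixHom (k : ℕ) (φ : Word → Word) :
    (prefixHom k φ).dom = genIdeal {x | x.length = k} := by
  ext x
  constructor
  · rintro ⟨y, hy⟩
    exact ⟨x.take k, by simpa using (prefixHom_eq_some.1 hy).1, List.take_prefix _ _⟩
  · rintro ⟨p, rfl, hpx⟩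
    exact ⟨_, prefixHom_eq_some.2 ⟨hpx.length_le, rfl⟩⟩

theorem im_prefixHom (k : ℕ) (φ : Word → Word) :
    (prefixHom k φ).im = genIdeal (φ '' {x | x.length = k}) := by
  ext y
  constructor
  · rintro ⟨x, hx⟩
    obtain ⟨hk, rfl⟩ := prefixHom_eq_some.1 hx
    exact ⟨_, ⟨x.take k, by simpa using hk, rfl⟩, List.prefix_append _ _⟩
  · rintro ⟨_, ⟨x, rfl, rfl⟩, z, rfl⟩
    exact ⟨x ++ z, prefixHom_eq_some.2 (by simp)⟩

theorem isMaximalPrefixCode_length_eq (k : ℕ) :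
    IsMaximalPrefixCode {x : Word | x.length = k} := by
  refine ⟨fun x hx y hy h => h.eq_of_length (hx.trans hy.symm), fun C hC hsub => ?_⟩
  refine Set.Subset.antisymm (fun y hy => ?_) hsub
  rcases le_total k y.length with h | h
  · have htake : y.take k ∈ {x : Word | x.length = k} := by simpa using h
    rwa [← hC _ (hsub htake) y hy (List.take_prefix _ _)]
  · have hpad : y ++ List.replicate (k - y.length) false ∈ {x : Word | x.length = k} := by
      simp only [Set.mem_ofPred_eq, List.length_append, List.length_replicate]
      omega
    rwa [hC y hy _ (hsub hpad) (List.prefix_append _ _)]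

theorem ofHom_prefixHom_mem_lepM21 {k r : ℕ} {φ : Word → Word}
    (hφ : ∀ x : Word, x.length = k → (φ x).length = r) :
    M21.ofHom (prefixHom k φ) ∈ lepM21 := by
  have hlen : ∀ x y, (prefixHom k φ).toFun x = some y → y.length + k = r + x.length := by
    intro x y h
    obtain ⟨hk, rfl⟩ := prefixHom_eq_some.1 h
    rw [List.length_append, hφ _ (by simpa using hk), List.length_drop]
    omega
  refine ⟨prefixHom k φ, {x | x.length = k}, φ '' {x | x.length = k}, List.finite_length_eq Bool k,
    (List.finite_length_eq Bool k).image _, isMaximalPrefixCode_length_eq k, ?_,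
    dom_prefixHom k φ, im_prefixHom k φ, fun x₁ x₂ y₁ y₂ h₁ h₂ he => ?_, rfl⟩
  · rintro _ ⟨x, hx, rfl⟩ _ ⟨y, hy, rfl⟩ h
    exact h.eq_of_length ((hφ x hx).trans (hφ y hy).symm)
  · have := hlen _ _ h₁
    have := hlen _ _ h₂
    omega

theorem ofHom_prefixHom_maps (k : ℕ) (φ : Word → Word) (s : Stream' Bool) :
    (M21.ofHom (prefixHom k φ)).Maps s (((φ (s.take k)).length : ℤ) - k)
      (φ (s.take k) ++ₛ s.drop k) := by
  rw [M21.ofHom_maps]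
  have h : (prefixHom k φ).toFun (s.take k) = some (φ (s.take k)) :=
    prefixHom_eq_some.2 ⟨by simp, by
      rw [List.take_of_length_le (by simp), List.drop_eq_nil_of_le (by simp), List.append_nil]⟩
  simpa only [Stream'.append_take_drop, Stream'.length_take] using
    RIHom.maps_append h (s.drop k)

/-! ### Position transpositions and gates -/

/-- The sequence whose `i`-th letter is the `σ i`-th letter of `s`. -/
def reindex (σ : ℕ → ℕ) (s : Stream' Bool) : Stream' Bool := fun i => s.get (σ i)

theorem get_reindex (σ : ℕ → ℕ) (s : Stream' Bool) (i : ℕ) :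
    (reindex σ s).get i = s.get (σ i) := rfl

/-- The position transposition `τ_{i,j}` as an element of `G_{2,1}`. -/
noncomputable def tauUnit (i j : ℕ) (hij : i < j) : G21 :=
  ⟨M21.ofHom (tauHom i j hij), M21.ofHom (tauHom i j hij), tau_mul_self i j hij,
    tau_mul_self i j hij⟩

theorem tauUnit_mem_tauG (i j : ℕ) (hij : i < j) : tauUnit i j hij ∈ tauG := ⟨i, j, hij, rfl⟩

theorem exists_eq_tauUnit {g : G21} (hg : g ∈ tauG) : ∃ i j hij, g = tauUnit i j hij := by
  obtain ⟨i, j, hij, h⟩ := hg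
  exact ⟨i, j, hij, Units.ext h⟩

theorem inv_mem_tauG {g : G21} (hg : g ∈ tauG) : g⁻¹ ∈ tauG := by
  obtain ⟨i, j, hij, rfl⟩ := exists_eq_tauUnit hg
  exact tauUnit_mem_tauG i j hij

theorem coe_mem_wordBall_tauM {S : Set M21} (hτ : tauM ⊆ S) {n : ℕ} {g : G21}
    (hg : g ∈ wordBall tauG n) : (g : M21) ∈ wordBall S n :=
  map_mem_wordBall (Units.coeHom M21) (fun _ hs => hτ hs) hg

theorem length_swapWord (i j : ℕ) (x : Word) : (swapWord i j x).length = x.length := by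
  simp [swapWord]

theorem swapWord_append_stream {i j : ℕ} (hij : i < j) {x : Word} (hj : j < x.length)
    (r : Stream' Bool) : swapWord i j x ++ₛ r = reindex (Equiv.swap i j) (x ++ₛ r) := by
  have hi : i < x.length := hij.trans hj
  refine Stream'.ext fun q => ?_
  rw [get_reindex]
  rcases lt_or_ge q x.length with hq | hq
  · rw [Stream'.get_append_left q _ r (by rwa [length_swapWord])]
    simp only [swapWord, List.getElem_set, List.getD_eq_getElem _ _ hi,
      List.getD_eq_getElem _ _ hj]
    rcases eq_or_ne j q with rfl | hjq
    · simp [Stream'.get_append_left i x r hi]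
    · rcases eq_or_ne i q with rfl | hiq
      · simp [hjq, Stream'.get_append_left j x r hj]
      · rw [Equiv.swap_apply_of_ne_of_ne hiq.symm hjq.symm, Stream'.get_append_left q x r hq]
        simp [hiq, hjq]
  · rw [Equiv.swap_apply_of_ne_of_ne (by omega) (by omega)]
    rw [get_append_stream_of_length_le r hq,
      get_append_stream_of_length_le r (by rwa [length_swapWord]), length_swapWord]

theorem tauUnit_maps {i j : ℕ} (hij : i < j) (s : Stream' Bool) :
    (tauUnit i j hij : M21).Maps s 0 (reindex (Equiv.swap i j) s) := by
  have h : (tauHom i j hij).toFun (s.take (j + 1)) = some (swapWord i j (s.take (j + 1))) :=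
    if_pos (by simp)
  have hmaps := RIHom.maps_append h (s.drop (j + 1))
  rw [swapWord_append_stream hij (by simp), Stream'.append_take_drop, length_swapWord,
    sub_self] at hmaps
  exact M21.ofHom_maps.2 hmaps

theorem exists_maps_swap (i j : ℕ) :
    ∃ P ∈ wordBall tauG 1, ∀ s, (P : M21).Maps s 0 (reindex (Equiv.swap i j) s) := by
  rcases lt_trichotomy i j with hij | rfl | hij
  · exact ⟨_, subset_wordBall_one (tauUnit_mem_tauG i j hij), tauUnit_maps hij⟩
  · refine ⟨1, one_mem_wordBall, fun s => ?_⟩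
    rw [Equiv.swap_self]
    exact M21.one_maps s
  · exact ⟨_, subset_wordBall_one (tauUnit_mem_tauG j i hij),
      fun s => Equiv.swap_comm j i ▸ tauUnit_maps hij s⟩

theorem exists_maps_perm {k : ℕ} (p : Fin k → ℕ) (hp : Function.Injective p) :
    ∃ π : Equiv.Perm ℕ, ∃ P ∈ wordBall tauG k,
      (∀ s, (P : M21).Maps s 0 (reindex π s)) ∧ ∀ i : Fin k, π i = p i := by
  induction k with
  | zero => exact ⟨1, 1, one_mem_wordBall, M21.one_maps, fun i => i.elim0⟩
  | succ k ih =>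
    obtain ⟨π, P, hP, hPπ, hπ⟩ := ih (p ∘ Fin.castSucc) (hp.comp (Fin.castSucc_injective k))
    obtain ⟨R, hR, hRs⟩ := exists_maps_swap k (π.symm (p (Fin.last k)))
    refine ⟨(Equiv.swap k (π.symm (p (Fin.last k)))).trans π, R * P,
      add_comm 1 k ▸ mul_mem_wordBall hR hP, fun s => (hRs _).mul_zero (hPπ s), fun i => ?_⟩
    induction i using Fin.lastCases with
    | last => simp
    | cast i =>
      have hne : (i : ℕ) ≠ π.symm (p (Fin.last k)) := by
        rw [Ne, Equiv.eq_symm_apply, hπ]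
        exact hp.ne (Fin.castSucc_lt_last i).ne
      rw [Equiv.trans_apply, Fin.val_castSucc, Equiv.swap_apply_of_ne_of_ne i.2.ne hne, hπ]
      rfl

section Gates

variable {S : Set M21}

/-- The gate that rewrites the first `k` letters by `f` is conjugated to the positions `p` by a
permutation of positions, which costs `2 k` transpositions wherever these positions are. -/
theorem exists_gate_fin (hτ : tauM ⊆ S) (hS : lepM21 ⊆ Submonoid.closure S) {k : ℕ}
    (f : (Fin k → Bool) → Fin k → Bool) : ∃ C, ∀ p : Fin k → ℕ, Function.Injective p →
      ∃ P ∈ wordBall S C, ∀ T T' : Stream' Bool, T'.get ∘ p = f (T.get ∘ p) →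
        (∀ q ∉ Set.range p, T'.get q = T.get q) → P.Maps T 0 T' := by
  let φ : Word → Word := fun x => List.ofFn (f fun i => x.getD i false)
  have hφ : ∀ x, (φ x).length = k := fun x => by simp [φ]
  obtain ⟨C, hC⟩ := exists_mem_wordBall (hS (ofHom_prefixHom_mem_lepM21 fun x _ => hφ x))
  refine ⟨k + C + k, fun p hp => ?_⟩
  obtain ⟨π, P, hP, hPπ, hπ⟩ := exists_maps_perm p hp
  refine ⟨↑P⁻¹ * M21.ofHom (prefixHom k φ) * P, mul_mem_wordBall (mul_mem_wordBall
    (coe_mem_wordBall_tauM hτ (inv_mem_wordBall (fun _ => inv_mem_tauG) hP)) hC)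
    (coe_mem_wordBall_tauM hτ hP), fun T T' hT' hoff => ?_⟩
  refine ((G21.maps_inv_zero (hPπ T')).mul_zero ?_).mul_zero (hPπ T)
  have hgate := ofHom_prefixHom_maps k φ (reindex π T)
  rw [hφ, sub_self] at hgate
  suffices h : reindex π T' = φ ((reindex π T).take k) ++ₛ (reindex π T).drop k from h ▸ hgate
  refine Stream'.ext fun q => ?_
  rw [get_reindex]
  rcases lt_or_ge q k with hq | hq
  · have hpq : p ⟨q, hq⟩ = π q := (hπ ⟨q, hq⟩).symm
    rw [Stream'.get_append_left q _ _ (by rwa [hφ]), ← hpq]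
    simp only [φ, List.getElem_ofFn]
    refine (congrFun hT' ⟨q, hq⟩).trans (congrFun (congrArg f (funext fun i => ?_)) _)
    simp [get_reindex, hπ]
  · have hq' : π q ∉ Set.range p := by
      rintro ⟨i, hi⟩
      have := i.2
      rw [← hπ, π.injective.eq_iff] at hi
      omega
    rw [get_append_stream_of_length_le _ (by rwa [hφ]), hφ, Stream'.get_drop, get_reindex,
      Nat.add_sub_cancel' hq]
    exact hoff _ hq'

theorem exists_gate (hτ : tauM ⊆ S) (hS : lepM21 ⊆ Submonoid.closure S) {ι : Type*} [Finite ι]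
    (f : (ι → Bool) → ι → Bool) : ∃ C, ∀ p : ι → ℕ, Function.Injective p →
      ∃ P ∈ wordBall S C, ∀ T T' : Stream' Bool, T'.get ∘ p = f (T.get ∘ p) →
        (∀ q ∉ Set.range p, T'.get q = T.get q) → P.Maps T 0 T' := by
  obtain ⟨k, ⟨e⟩⟩ := Finite.exists_equiv_fin ι
  obtain ⟨C, hC⟩ := exists_gate_fin hτ hS fun b : Fin k → Bool => f (b ∘ e) ∘ e.symm
  refine ⟨C, fun p hp => ?_⟩
  obtain ⟨P, hP, hPmaps⟩ := hC (p ∘ e.symm) (hp.comp e.symm.injective)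
  refine ⟨P, hP, fun T T' hT' hoff => hPmaps T T' ?_ ?_⟩
  · rw [← Function.comp_assoc, hT', Function.comp_assoc, Function.comp_assoc, e.symm_comp_self,
      Function.comp_id]
  · rwa [e.symm.surjective.range_comp]

theorem exists_markedGate (hτ : tauM ⊆ S) (hS : lepM21 ⊆ Submonoid.closure S) {ι : Type*}
    [Finite ι] (f : (ι → Bool) → ι → Bool) (k : ι) :
    ∃ C, ∀ p : ι → ℕ, Function.Injective p → ∀ z ∉ Set.range p, ∃ P ∈ wordBall S C,
      (∀ T : Stream' Bool, T.get z = true ∨ T.get (p k) = false → P.Maps T 0 T) ∧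
      ∀ T T' : Stream' Bool, T.get z = false → T.get (p k) = true → T'.get z = true →
        T'.get ∘ p = f (T.get ∘ p) → (∀ q ∉ Set.range p, q ≠ z → T'.get q = T.get q) →
        P.Maps T 0 T' := by
  let F : (Option ι → Bool) → Option ι → Bool := fun b i =>
    if b none = false ∧ b (some k) = true then i.elim true (f (b ∘ some)) else b i
  obtain ⟨C, hC⟩ := exists_gate hτ hS F
  refine ⟨C, fun p hp z hz => ?_⟩
  let e := Function.Embedding.optionElim ⟨p, hp⟩ z hz
  obtain ⟨P, hP, hPmaps⟩ := hC e e.injective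
  refine ⟨P, hP, fun T hT => hPmaps T T ?_ fun _ _ => rfl,
    fun T T' hTz hflag hT'z hT' hoff => hPmaps T T' ?_ fun q hq => hoff q ?_ ?_⟩
  · have hcond : ¬ (T.get z = false ∧ T.get (p k) = true) := by
      rcases hT with h | h <;> simp [h]
    exact (funext fun i => if_neg hcond).symm
  · have hcond : T.get z = false ∧ T.get (p k) = true := ⟨hTz, hflag⟩
    funext i
    refine Eq.trans ?_ (if_pos hcond).symm
    cases i with
    | none => exact hT'z
    | some i => exact congrFun hT' i
  · rintro ⟨i, rfl⟩
    exact hq ⟨some i, rfl⟩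
  · rintro rfl
    exact hq ⟨none, rfl⟩

/-- A gate that has acted sets a bit at the position `z`, and the later gates respect this bit. -/
theorem exists_firstMatch_marked (hτ : tauM ⊆ S) (hS : lepM21 ⊆ Submonoid.closure S) {ι : Type*}
    [Finite ι] (f : (ι → Bool) → ι → Bool) (k : ι) :
    ∃ C, ∀ n (p : ℕ → ι → ℕ) (z : ℕ), (∀ a < n, Function.Injective (p a)) →
      (∀ a < n, z ∉ Set.range (p a)) → ∃ P ∈ wordBall S (n * C),
        (∀ T : Stream' Bool, (∀ a < n, T.get (p a k) = false) → P.Maps T 0 T) ∧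
        ∀ T T' : Stream' Bool, ∀ a < n, T.get z = false → T.get (p a k) = true →
          (∀ b < a, T.get (p b k) = false) → T'.get z = true →
          T'.get ∘ p a = f (T.get ∘ p a) → (∀ q ∉ Set.range (p a), q ≠ z → T'.get q = T.get q) →
          P.Maps T 0 T' := by
  obtain ⟨C, hC⟩ := exists_markedGate hτ hS f k
  refine ⟨C, fun n p z hp hz => ?_⟩
  induction n with
  | zero => exact ⟨1, one_mem_wordBall, fun T _ => M21.one_maps T, fun _ _ a ha => by omega⟩
  | succ n ih =>
    obtain ⟨P, hP, hidle, hact⟩ := ih (fun a ha => hp a (by omega)) fun a ha => hz a (by omega)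
    obtain ⟨G, hG, hGidle, hGact⟩ := hC (p n) (hp n n.lt_succ_self) z (hz n n.lt_succ_self)
    refine ⟨G * P, wordBall_mono (by linarith) (mul_mem_wordBall hG hP),
      fun T hT => ?_, fun T T' a ha hTz hflag hbefore hT'z hT' hoff => ?_⟩
    · exact (hGidle T (.inr (hT n n.lt_succ_self))).mul_zero
        (hidle T fun a ha => hT a (by omega))
    · rcases Nat.lt_succ_iff_lt_or_eq.1 ha with ha | rfl
      · exact (hGidle T' (.inl hT'z)).mul_zero
          (hact T T' a ha hTz hflag hbefore hT'z hT' hoff)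
      · exact (hGact T T' hTz hflag hT'z hT' hoff).mul_zero (hidle T hbefore)

theorem exists_firstMatch (hτ : tauM ⊆ S) (hS : lepM21 ⊆ Submonoid.closure S) {ι : Type*}
    [Finite ι] (f : (ι → Bool) → ι → Bool) (k : ι) :
    ∃ C, ∀ n (p : ℕ → ι → ℕ) (z : ℕ), (∀ a < n, Function.Injective (p a)) →
      (∀ a < n, z ∉ Set.range (p a)) → ∃ P ∈ wordBall S ((n + 1) * C), ∀ T T' : Stream' Bool,
        ∀ a < n, T.get z = false → T.get (p a k) = true → (∀ b < a, T.get (p b k) = false) →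
          T'.get ∘ p a = f (T.get ∘ p a) → (∀ q ∉ Set.range (p a), T'.get q = T.get q) →
          P.Maps T 0 T' := by
  obtain ⟨C, hC⟩ := exists_firstMatch_marked hτ hS f k
  obtain ⟨C', hC'⟩ := exists_gate hτ hS fun (_ : Unit → Bool) _ => false
  refine ⟨C + C', fun n p z hp hz => ?_⟩
  obtain ⟨P, hP, -, hact⟩ := hC n p z hp hz
  obtain ⟨R, hR, hreset⟩ := hC' (fun _ => z) (Function.injective_of_subsingleton _)
  refine ⟨R * P, wordBall_mono (by nlinarith) (mul_mem_wordBall hR hP),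
    fun T T' a ha hTz hflag hbefore hT' hoff => ?_⟩
  obtain ⟨U, hUz, hU⟩ : ∃ U : Stream' Bool, U.get z = true ∧ ∀ q ≠ z, U.get q = T'.get q :=
    ⟨Function.update T'.get z true, Function.update_self .., fun q hq =>
      Function.update_of_ne hq ..⟩
  have hTU : P.Maps T 0 U := by
    refine hact T U a ha hTz hflag hbefore hUz ?_ fun q hq hqz => (hU q hqz).trans (hoff q hq)
    refine Eq.trans (funext fun i => hU _ fun h => hz a ha ⟨i, h⟩) hT'
  refine (hreset U T' (funext fun _ => (hoff z (hz a ha)).trans hTz) fun q hq => ?_).mul_zero hTU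
  exact (hU q fun h => hq ⟨(), h.symm⟩).symm

end Gates

/-! ### Simulation of `M_{2,1}` by `lepM_{2,1}` -/

theorem M21.exists_window (γ : M21) : ∃ K, ∀ s d t, γ.Maps s d t → ∃ y : Word,
    γ.act (s.take K) = some y ∧ y.length ≤ 2 * K ∧ d = y.length - K ∧ t = y ++ₛ s.drop K := by
  obtain ⟨P, hP, hdom⟩ := γ.1.fg
  rw [RIHom.isSome_set_eq] at hdom
  obtain ⟨K₁, hK₁⟩ := (hP.image List.length).bddAbove
  obtain ⟨K₂, hK₂⟩ := (hP.image fun p => ((γ.act p).getD []).length).bddAbove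
  refine ⟨max K₁ K₂, fun s d t h => ?_⟩
  set K := max K₁ K₂
  obtain ⟨x, y, r, hl, hxy, hs, -, -⟩ := h.exists_le_length K
  obtain ⟨p, hp, hpx⟩ : x ∈ genIdeal P := hdom ▸ ⟨y, hxy⟩
  obtain ⟨w, hw⟩ : p ∈ γ.1.dom := hdom ▸ ⟨p, hp, List.prefix_refl p⟩
  have hpK : p.length ≤ K := (hK₁ ⟨p, hp, rfl⟩).trans (le_max_left _ _)
  have hwK : w.length ≤ K := by
    have hw' : γ.act p = some w := hw
    exact (by simpa [hw'] using hK₂ ⟨p, hp, rfl⟩ : w.length ≤ K₂).trans (le_max_right _ _)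
  have htake : s.take K = x.take K := by rw [hs, Stream'.take_append_of_le_length _ _ _ hl]
  obtain ⟨z, hz⟩ : p <+: s.take K := htake ▸ List.prefix_take_iff.2 ⟨hpx, hpK⟩
  have hpz : p.length + z.length = K := by rw [← List.length_append, hz, Stream'.length_take]
  have hact : γ.act (s.take K) = some (w ++ z) := hz ▸ γ.1.map_append _ _ z hw
  have hmaps := M21.maps_of_act hact (s.drop K)
  rw [Stream'.append_take_drop, Stream'.length_take] at hmaps
  obtain ⟨hd, ht⟩ := h.unique hmaps
  exact ⟨w ++ z, hact, by rw [List.length_append]; omega, hd, ht⟩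

/-- The sequence that holds `u` from position `L + 1 + a` on. Among the positions below, which are
`L` flags, one marker bit and `a` free cells, only the flag `a` is set, so that an increase of the
offset of `u` is recorded by the flags. -/
def encode (L a : ℕ) (u : Stream' Bool) : Stream' Bool :=
  (List.range (L + 1 + a)).map (fun q => decide (q = a)) ++ₛ u

theorem get_encode_of_lt {L a q : ℕ} (u : Stream' Bool) (h : q < L + 1 + a) :
    (encode L a u).get q = decide (q = a) := by
  rw [encode, Stream'.get_append_left q _ _ (by simpa using h)]
  simp

theorem get_encode_of_le {L a q : ℕ} (u : Stream' Bool) (h : L + 1 + a ≤ q) :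
    (encode L a u).get q = u.get (q - (L + 1 + a)) := by
  rw [encode, get_append_stream_of_length_le u (by simpa using h)]
  simp

theorem drop_encode (L a : ℕ) (u : Stream' Bool) : (encode L a u).drop (L + 1 + a) = u := by
  have h := Stream'.drop_append_stream ((List.range (L + 1 + a)).map fun q => decide (q = a)) u
  rwa [List.length_map, List.length_range] at h

/-- `w` changes lengths by at most `r`, and on the encodings whose flag is at distance at least
`r` from the ends of an array of `L` flags it acts like some length-preserving element of
word-length at most `(L + 1) * C` over `S`. -/
def Simulates (S : Set M21) (C r : ℕ) (w : M21) : Prop :=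
  ∀ L, ∃ P ∈ wordBall S ((L + 1) * C), ∀ (a : ℕ) u d v, r ≤ a → a + r < L → w.Maps u d v →
    |d| ≤ r ∧ ∃ a' : ℕ, (a' : ℤ) = a - d ∧ P.Maps (encode L a u) 0 (encode L a' v)

section Simulation

variable {S T : Set M21} {C C' r r' : ℕ} {w w' : M21}

theorem Simulates.mono (h : Simulates S C r w) (hC : C ≤ C') (hr : r ≤ r') :
    Simulates S C' r' w := by
  intro L
  obtain ⟨P, hP, hsim⟩ := h L
  refine ⟨P, wordBall_mono (Nat.mul_le_mul_left _ hC) hP, fun a u d v ha haL hw => ?_⟩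
  obtain ⟨hd, h⟩ := hsim a u d v (by omega) (by omega) hw
  exact ⟨by omega, h⟩

theorem Simulates.one : Simulates S 0 0 1 := by
  refine fun L => ⟨1, one_mem_wordBall, fun a u d v _ _ hw => ?_⟩
  obtain ⟨rfl, rfl⟩ := hw.unique (M21.one_maps u)
  exact ⟨by simp, a, by simp, M21.one_maps _⟩

theorem Simulates.mul (h : Simulates S C r w) (h' : Simulates S C' r' w') :
    Simulates S (C + C') (r + r') (w * w') := by
  intro L
  obtain ⟨P, hP, hsim⟩ := h L
  obtain ⟨P', hP', hsim'⟩ := h' L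
  refine ⟨P * P', mul_add _ C C' ▸ mul_mem_wordBall hP hP', fun a u d v ha haL hw => ?_⟩
  obtain ⟨d₁, t, d₂, hw₁, hw₂, rfl⟩ := M21.mul_maps.1 hw
  obtain ⟨hd₁, a₁, ha₁, hP₁⟩ := hsim' a u d₁ t (by omega) (by omega) hw₁
  have hd₁' := abs_le.1 hd₁
  obtain ⟨hd₂, a₂, ha₂, hP₂⟩ := hsim a₁ t d₂ v (by omega) (by omega) hw₂
  have hd₂' := abs_le.1 hd₂
  exact ⟨abs_le.2 (by omega), a₂, by omega, hP₂.mul_zero hP₁⟩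

theorem Simulates.of_mem_pow (h : ∀ w ∈ T, Simulates S C r w) (n : ℕ) :
    ∀ w ∈ T ^ n, Simulates S (n * C) (n * r) w := by
  induction n with
  | zero =>
    rintro w hw
    rw [pow_zero, Set.mem_one] at hw
    simpa [hw] using Simulates.one
  | succ n ih =>
    rw [pow_succ, add_mul, add_mul, one_mul, one_mul]
    rintro _ ⟨x, hx, y, hy, rfl⟩
    exact (ih x hx).mul (h y hy)

theorem exists_simulates_tauM (hτ : tauM ⊆ S) (hS : lepM21 ⊆ Submonoid.closure S) :
    ∃ C, ∀ w ∈ tauM, Simulates S C 0 w := by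
  obtain ⟨C, hC⟩ := exists_firstMatch hτ hS (ι := Option Bool)
    (fun b x => b (x.map not)) none
  refine ⟨C, ?_⟩
  rintro _ ⟨i, j, hij, rfl⟩ L
  let p : ℕ → Option Bool → ℕ := fun a x =>
    x.elim a fun b => L + 1 + a + if b then j else i
  have hp : ∀ a < L, Function.Injective (p a) := by
    rintro a ha (_ | _ | _) (_ | _ | _) h <;> simp [p] at h ⊢ <;> omega
  have hL : ∀ a < L, L ∉ Set.range (p a) := by
    rintro a ha ⟨_ | _ | _, h⟩ <;> simp [p] at h <;> omega
  obtain ⟨P, hP, hPmaps⟩ := hC L p L hp hL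
  refine ⟨P, hP, fun a u d v _ haL hw => ?_⟩
  obtain ⟨rfl, rfl⟩ := hw.unique (tauUnit_maps hij u)
  have hflag : ∀ (q : ℕ) (t : Stream' Bool), q < L + 1 →
      (encode L a t).get q = decide (q = a) := fun q t hq => get_encode_of_lt t (by omega)
  have hletter : ∀ (q : ℕ) (t : Stream' Bool), (encode L a t).get (L + 1 + a + q) = t.get q :=
    fun q t => by rw [get_encode_of_le t (by omega), Nat.add_sub_cancel_left]
  refine ⟨by simp, a, by simp, hPmaps _ _ a haL ?_ ?_ (fun b hb => ?_) ?_ fun q hq => ?_⟩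
  · rw [hflag L u (by omega), decide_eq_false (by omega)]
  · rw [show p a none = a from rfl, hflag a u (by omega), decide_eq_true rfl]
  · rw [show p b none = b from rfl, hflag b u (by omega), decide_eq_false (by omega)]
  · funext x
    match x with
    | none => exact (hflag a _ (by omega)).trans (hflag a u (by omega)).symm
    | some false => simp [p, hletter, get_reindex]
    | some true => simp [p, hletter, get_reindex]
  · rcases lt_or_ge q (L + 1 + a) with hqa | hqa
    · rw [get_encode_of_lt _ hqa, get_encode_of_lt _ hqa]
    · obtain ⟨q, rfl⟩ := Nat.exists_eq_add_of_le hqa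
      rw [hletter, hletter, get_reindex, Equiv.swap_apply_of_ne_of_ne]
      · rintro rfl
        exact hq ⟨some false, rfl⟩
      · rintro rfl
        exact hq ⟨some true, rfl⟩

end Simulation

/-- The positions that an element replacing `K` letters by at most `2 * K` letters affects in
`encode L (b + K) u`: `2 * K + 1` flags, and the last `K` free cells followed by the first `K`
letters of `u`. -/
def windowPos (L K b : ℕ) : Fin (2 * K + 1) ⊕ Fin (2 * K) → ℕ :=
  Sum.elim (fun i => b + i) fun i => L + 1 + b + i

/-- The action of `γ` on the letters at `windowPos L K b`: its value, padded on the left to length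
`2 * K`, overwrites the cells, and the flags record the length of the padding. -/
def windowGate (γ : M21) (K : ℕ) (c : Fin (2 * K + 1) ⊕ Fin (2 * K) → Bool) :
    Fin (2 * K + 1) ⊕ Fin (2 * K) → Bool :=
  let y := (γ.act (List.ofFn fun i : Fin K => c (.inr ⟨K + i, by omega⟩))).getD []
  Sum.elim (fun i => decide (i + y.length = 2 * K))
    fun i => (List.replicate (2 * K - y.length) false ++ y).getD i false

theorem injective_windowPos {L K b : ℕ} (h : b + 2 * K < L) :
    Function.Injective (windowPos L K b) := by
  rintro (⟨i, hi⟩ | ⟨i, hi⟩) (⟨j, hj⟩ | ⟨j, hj⟩) h <;> simp [windowPos] at h ⊢ <;> omega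

theorem notMem_range_windowPos {L K b : ℕ} (h : b + 2 * K < L) :
    L ∉ Set.range (windowPos L K b) := by
  rintro ⟨⟨i, hi⟩ | ⟨i, hi⟩, h⟩ <;> simp [windowPos] at h <;> omega

section Window

variable {γ : M21} {L K b : ℕ} {u : Stream' Bool} {y : Word}

theorem encode_comp_windowPos (h : b + 2 * K < L) (hy : γ.act (u.take K) = some y)
    (hyK : y.length ≤ 2 * K) :
    (encode L (b + (2 * K - y.length)) (y ++ₛ u.drop K)).get ∘ windowPos L K b =
      windowGate γ K ((encode L (b + K) u).get ∘ windowPos L K b) := by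
  have hread : (List.ofFn fun i : Fin K =>
      (encode L (b + K) u).get (windowPos L K b (.inr ⟨K + i, by omega⟩))) = u.take K := by
    refine List.ext_getElem (by simp) fun i hi _ => ?_
    rw [List.getElem_ofFn, Stream'.take_get]
    refine (get_encode_of_le u ?_).trans (congrArg u.get ?_) <;> simp [windowPos] <;> omega
  funext x
  simp only [windowGate, Function.comp_apply, hread, hy, Option.getD_some]
  rcases x with ⟨i, hi⟩ | ⟨i, hi⟩
  · simp only [windowPos, Sum.elim_inl]
    rw [get_encode_of_lt _ (by omega), decide_eq_decide]
    omega
  · simp only [windowPos, Sum.elim_inr]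
    rcases lt_or_ge i (2 * K - y.length) with hiy | hiy
    · rw [get_encode_of_lt _ (by omega), List.getD_append _ _ _ _ (by simpa using hiy)]
      simp [hiy]
      omega
    · rw [get_encode_of_le _ (by omega), List.getD_append_right _ _ _ _ (by simpa using hiy),
        List.length_replicate, Stream'.get_append_left _ _ _ (by omega),
        List.getD_eq_getElem _ _ (by omega)]
      congr 1
      omega

theorem get_encode_of_notMem_windowPos (h : b + 2 * K < L) (hyK : y.length ≤ 2 * K) {q : ℕ}
    (hq : q ∉ Set.range (windowPos L K b)) :
    (encode L (b + (2 * K - y.length)) (y ++ₛ u.drop K)).get q = (encode L (b + K) u).get q := by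
  have hflag : ¬ (b ≤ q ∧ q < b + (2 * K + 1)) := fun hbq =>
    hq ⟨.inl ⟨q - b, by omega⟩, by simp only [windowPos, Sum.elim_inl]; omega⟩
  have hcell : ¬ (L + 1 + b ≤ q ∧ q < L + 1 + b + 2 * K) := fun hbq =>
    hq ⟨.inr ⟨q - (L + 1 + b), by omega⟩, by simp only [windowPos, Sum.elim_inr]; omega⟩
  rcases lt_or_ge q (L + 1 + b) with hqb | hqb
  · rw [get_encode_of_lt _ (by omega), get_encode_of_lt _ (by omega), decide_eq_decide]
    omega
  · rw [get_encode_of_le _ (by omega), get_encode_of_le _ (by omega),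
      get_append_stream_of_length_le _ (by omega), Stream'.get_drop]
    congr 1
    omega

end Window

section Simulation

variable {S : Set M21}

theorem exists_simulates (hτ : tauM ⊆ S) (hS : lepM21 ⊆ Submonoid.closure S) (γ : M21) :
    ∃ C r, Simulates S C r γ := by
  obtain ⟨K, hK⟩ := γ.exists_window
  obtain ⟨C, hC⟩ := exists_firstMatch hτ hS (windowGate γ K) (.inl ⟨K, by omega⟩)
  refine ⟨C, K, fun L => ?_⟩
  obtain ⟨P, hP, hPmaps⟩ := hC (L - 2 * K) (windowPos L K) L
    (fun b hb => injective_windowPos (by omega)) fun b hb => notMem_range_windowPos (by omega)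
  refine ⟨P, wordBall_mono (Nat.mul_le_mul_right _ (by omega)) hP, fun a u d v ha haL hw => ?_⟩
  obtain ⟨y, hy, hyK, rfl, rfl⟩ := hK _ _ _ hw
  obtain ⟨b, rfl⟩ := Nat.exists_eq_add_of_le' ha
  have hb : b + 2 * K < L := by omega
  have hflag : ∀ q < L + 1, (encode L (b + K) u).get q = decide (q = b + K) :=
    fun q hq => get_encode_of_lt u (by omega)
  refine ⟨abs_le.2 (by omega), b + (2 * K - y.length), by omega,
    hPmaps _ _ b (by omega) ?_ ?_ (fun c hc => ?_) (encode_comp_windowPos hb hy hyK)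
      fun q hq => get_encode_of_notMem_windowPos hb hyK hq⟩
  · rw [hflag L (by omega), decide_eq_false (by omega)]
  · exact (hflag (b + K) (by omega)).trans (decide_eq_true rfl)
  · exact (hflag (c + K) (by omega)).trans (decide_eq_false (by omega))

theorem exists_simulates_generators (hτ : tauM ⊆ S) (hS : lepM21 ⊆ Submonoid.closure S)
    {Γ : Set M21} (hΓ : Γ.Finite) : ∃ C r, ∀ w ∈ Γ ∪ tauM, Simulates S C r w := by
  obtain ⟨C₀, hC₀⟩ := exists_simulates_tauM hτ hS
  choose C r hC using exists_simulates hτ hS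
  obtain ⟨C₁, hC₁⟩ := (hΓ.image C).bddAbove
  obtain ⟨r₁, hr₁⟩ := (hΓ.image r).bddAbove
  refine ⟨max C₀ C₁, r₁, ?_⟩
  rintro w (hw | hw)
  · exact (hC w).mono ((hC₁ ⟨w, hw, rfl⟩).trans (le_max_right _ _)) (hr₁ ⟨w, hw, rfl⟩)
  · exact (hC₀ w hw).mono (le_max_left _ _) (Nat.zero_le _)

theorem exists_prepend (hS : lepM21 ⊆ Submonoid.closure S) : ∃ C, ∀ x : Word,
    ∃ P ∈ wordBall S (x.length * C), ∀ s, P.Maps s x.length (x ++ₛ s) := by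
  choose C hC using fun b : Bool => exists_mem_wordBall
    (hS (ofHom_prefixHom_mem_lepM21 (k := 0) (r := 1) (φ := fun _ => [b]) fun _ _ => rfl))
  refine ⟨max (C false) (C true), fun x => ?_⟩
  induction x with
  | nil => exact ⟨1, one_mem_wordBall, M21.one_maps⟩
  | cons b x ih =>
    obtain ⟨P, hP, hPmaps⟩ := ih
    have hb : C b ≤ max (C false) (C true) := by cases b <;> simp
    refine ⟨_, wordBall_mono ?_ (mul_mem_wordBall (hC b) hP), fun s => ?_⟩
    · rw [List.length_cons, add_mul, one_mul, add_comm]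
      exact Nat.add_le_add_left hb _
    · have h := (ofHom_prefixHom_maps 0 (fun _ => [b]) (x ++ₛ s)).mul (hPmaps s)
      simpa [Stream'.cons_append_stream] using h

theorem exists_drop (hS : lepM21 ⊆ Submonoid.closure S) : ∃ C, ∀ n : ℕ,
    ∃ P ∈ wordBall S (n * C), ∀ s, P.Maps s (-n) (s.drop n) := by
  obtain ⟨C, hC⟩ := exists_mem_wordBall
    (hS (ofHom_prefixHom_mem_lepM21 (k := 1) (r := 0) (φ := fun _ => []) fun _ _ => rfl))
  refine ⟨C, fun n => ⟨_, pow_mem_wordBall hC n, ?_⟩⟩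
  induction n with
  | zero => exact M21.one_maps
  | succ n ih =>
    intro s
    have h := (ih (s.drop 1)).mul (ofHom_prefixHom_maps 1 (fun _ => []) s)
    rw [pow_succ]
    simpa [Stream'.drop_drop, add_comm] using h

theorem exists_mem_wordBall_of_simulates (hS : lepM21 ⊆ Submonoid.closure S) : ∃ B,
    ∀ C r, ∀ g ∈ lpG21, Simulates S C r (g : M21) →
      (g : M21) ∈ wordBall S ((3 * r + 2) * (B + C)) := by
  obtain ⟨B, hB⟩ := exists_prepend hS
  obtain ⟨B', hB'⟩ := exists_drop hS
  refine ⟨B + B', fun C r g hg hsim => ?_⟩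
  obtain ⟨P, hP, hPmaps⟩ := hsim (2 * r + 1)
  let x : Word := (List.range (2 * r + 1 + 1 + r)).map fun q => decide (q = r)
  have hx : x.length = 3 * r + 2 := by simp only [x, List.length_map, List.length_range]; omega
  obtain ⟨Q, hQ, hQmaps⟩ := hB x
  obtain ⟨Q', hQ', hQmaps'⟩ := hB' x.length
  have hfactor : (g : M21) = Q' * P * Q := by
    refine M21.ext_of_exists_maps fun s => ?_
    obtain ⟨d, t, hst⟩ := G21.maps_total g s
    obtain rfl := mem_lpG21_iff.1 hg _ _ _ hst
    obtain ⟨-, a', ha', hencode⟩ := hPmaps r s 0 t le_rfl (by omega) hst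
    obtain rfl : r = a' := by omega
    refine ⟨0, t, hst, ?_⟩
    have h := ((hQmaps' _).mul hencode).mul (hQmaps s)
    have hdrop : (encode (2 * r + 1) r t).drop x.length = t := by
      rw [show x.length = 2 * r + 1 + 1 + r by omega, drop_encode]
    simpa [hdrop] using h
  rw [hfactor]
  refine wordBall_mono ?_ (mul_mem_wordBall (mul_mem_wordBall hQ' hP) hQ)
  rw [hx]
  nlinarith [Nat.zero_le (r * C)]

theorem exists_mem_wordBall_quadratic (hτ : tauM ⊆ S) (hS : lepM21 ⊆ Submonoid.closure S)
    {Γ : Set M21} (hΓ : Γ.Finite) : ∃ C, ∀ n, ∀ g ∈ lpG21,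
      (g : M21) ∈ wordBall (Γ ∪ tauM) n → (g : M21) ∈ wordBall S (C * n ^ 2) := by
  obtain ⟨C, r, hsim⟩ := exists_simulates_generators hτ hS hΓ
  obtain ⟨B, hB⟩ := exists_mem_wordBall_of_simulates hS
  refine ⟨(3 * r + 2) * (B + C), fun n g hg hn => ?_⟩
  obtain ⟨m, hm, hgm⟩ := mem_wordBall_iff.1 hn
  rcases m.eq_zero_or_pos with rfl | hpos
  · rw [pow_zero, Set.mem_one] at hgm
    exact hgm ▸ one_mem_wordBall
  · refine wordBall_mono ?_ (hB _ _ g hg (Simulates.of_mem_pow hsim m _ hgm))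
    calc (3 * (m * r) + 2) * (B + m * C) ≤ (m * (3 * r + 2)) * (m * (B + C)) := by
          gcongr <;> nlinarith
      _ = (3 * r + 2) * (B + C) * m ^ 2 := by ring
      _ ≤ (3 * r + 2) * (B + C) * n ^ 2 := by gcongr

end Simulation

/-! ### The Schreier graph of `G_{2,1} / Fix(0)` -/

section SchreierGraph

variable {H : Type*} [Group H] {F : Subgroup H} {S : Set H}

theorem exists_schreierEdge_path_iff {k : ℕ} {v : H ⧸ F} :
    (∃ p : ℕ → H ⧸ F, p 0 = (1 : H) ∧ p k = v ∧ ∀ i < k, schreierEdge F S (p i) (p (i + 1))) ↔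
      ∃ w ∈ S ^ k, (w : H ⧸ F) = v := by
  induction k generalizing v with
  | zero =>
    simp only [pow_zero, Set.mem_one, exists_eq_left]
    exact ⟨fun ⟨p, h0, hv, _⟩ => h0.symm.trans hv, fun h => ⟨fun _ => v, h.symm, rfl, by simp⟩⟩
  | succ k ih =>
    constructor
    · rintro ⟨p, h0, rfl, hp⟩
      obtain ⟨w, hw, hwp⟩ := ih.1 ⟨p, h0, rfl, fun i hi => hp i (by omega)⟩
      obtain ⟨γ, hγ, h, hh, hv⟩ := hp k k.lt_succ_self
      refine ⟨γ * w, pow_succ' S k ▸ Set.mul_mem_mul hγ hw, ?_⟩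
      rw [hv]
      exact congrArg (γ • ·) (hwp.trans hh)
    · rintro ⟨w, hw, rfl⟩
      rw [pow_succ'] at hw
      obtain ⟨γ, hγ, w, hw, rfl⟩ := hw
      obtain ⟨p, h0, hk, hp⟩ := ih.2 ⟨w, hw, rfl⟩
      refine ⟨Function.update p (k + 1) (γ * w : H), by simpa using h0, by simp, fun i hi => ?_⟩
      rw [Function.update_of_ne (by omega)]
      rcases Nat.lt_succ_iff_lt_or_eq.1 hi with hi | rfl
      · rw [Function.update_of_ne (by omega)]
        exact hp i hi
      · rw [Function.update_self]
        exact ⟨γ, hγ, w, hk, rfl⟩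

theorem pathDist_schreierEdge_le_iff {n : ℕ} {v : H ⧸ F} :
    pathDist (schreierEdge F S) (1 : H) v ≤ n ↔ ∃ w ∈ wordBall S n, (w : H ⧸ F) = v := by
  refine iInf₂_natCast_le_iff.trans ?_
  simp only [exists_schreierEdge_path_iff, mem_wordBall_iff]
  constructor
  · rintro ⟨k, ⟨w, hw, hv⟩, hk⟩
    exact ⟨w, ⟨k, hk, hw⟩, hv⟩
  · rintro ⟨w, ⟨k, hk, hw⟩, hv⟩
    exact ⟨k, ⟨w, hw, hv⟩, hk⟩

end SchreierGraph

theorem mem_fix0_iff {g : G21} : g ∈ fix0 ↔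
    ∀ s, (g : M21).Maps (Stream'.cons false s) 0 (Stream'.cons false s) := by
  constructor
  · intro h s
    simpa using M21.maps_of_act (h []) s
  · intro h x
    refine M21.act_eq_some_iff.2 fun r => ?_
    rw [sub_self, Stream'.cons_append_stream]
    exact h _

theorem lift0_maps {g : G21} {s t : Stream' Bool} {d : ℤ} (h : (g : M21).Maps s d t) :
    (lift0 g : M21).Maps (Stream'.cons false s) d (Stream'.cons false t) := by
  obtain ⟨x, y, r, hxy, rfl, rfl, hd⟩ := h
  refine M21.ofHom_maps.2 ⟨false :: x, false :: y, r, ?_, rfl, rfl, ?_⟩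
  · rw [lift0Hom_false, hxy]
    rfl
  · simp only [List.length_cons, Nat.cast_add, Nat.cast_one]
    omega

theorem lift0_inv_mul_mul_lift0_mem_fix0 {f : G21} (hf : f ∈ fix0) (g : G21) :
    (lift0 g)⁻¹ * f * lift0 g ∈ fix0 := by
  refine mem_fix0_iff.2 fun s => ?_
  obtain ⟨d, t, h⟩ := g.maps_total s
  have h' := ((G21.maps_inv (lift0_maps h)).mul (mem_fix0_iff.1 hf t)).mul (lift0_maps h)
  simpa using h'

section SchreierDist

variable {S : Set G21}

theorem schreierDist_one_le_iff {n : ℕ} {g : G21} : schreierDist S 1 g ≤ n ↔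
    ∃ w ∈ wordBall S n, (w : G21 ⧸ fix0) = lift0 g := by
  rw [schreierDist, map_one]
  exact pathDist_schreierEdge_le_iff

theorem exists_schreierDist_one_le (hS : Submonoid.closure S = ⊤) (g : G21) :
    ∃ n : ℕ, schreierDist S 1 g ≤ n := by
  obtain ⟨n, hn⟩ := exists_mem_wordBall (hS ▸ Submonoid.mem_top (lift0 g))
  exact ⟨n, schreierDist_one_le_iff.2 ⟨_, hn, rfl⟩⟩

theorem schreierDist_one_mul_le {m n : ℕ} {g h : G21} (hg : schreierDist S 1 g ≤ m)
    (hh : schreierDist S 1 h ≤ n) : schreierDist S 1 (g * h) ≤ (m + n : ℕ) := by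
  obtain ⟨v, hv, hvg⟩ := schreierDist_one_le_iff.1 hg
  obtain ⟨w, hw, hwh⟩ := schreierDist_one_le_iff.1 hh
  refine schreierDist_one_le_iff.2 ⟨v * w, mul_mem_wordBall hv hw, ?_⟩
  rw [QuotientGroup.eq] at hvg hwh ⊢
  have key := fix0.mul_mem hwh (lift0_inv_mul_mul_lift0_mem_fix0 hvg h)
  rw [map_mul]
  convert key using 1
  group

theorem reindex_swap_succ_cons (i j : ℕ) (b : Bool) (s : Stream' Bool) :
    reindex (Equiv.swap (i + 1) (j + 1)) (Stream'.cons b s) =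
      Stream'.cons b (reindex (Equiv.swap i j) s) := by
  refine Stream'.ext fun q => ?_
  cases q with
  | zero =>
    rw [get_reindex, Equiv.swap_apply_of_ne_of_ne (by omega) (by omega)]
    rfl
  | succ q =>
    have hswap : Equiv.swap (i + 1) (j + 1) (q + 1) = Equiv.swap i j q + 1 :=
      (add_left_injective 1).swap_apply i j q
    rw [get_reindex, hswap, Stream'.get_succ_cons, Stream'.get_succ_cons, get_reindex]

theorem schreierDist_one_tauUnit_le (hτ : tauG ⊆ S) {i j : ℕ} (hij : i < j) :
    schreierDist S 1 (tauUnit i j hij) ≤ (1 : ℕ) := by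
  have hij' : i + 1 < j + 1 := by omega
  refine schreierDist_one_le_iff.2
    ⟨tauUnit _ _ hij', subset_wordBall_one (hτ (tauUnit_mem_tauG _ _ hij')), ?_⟩
  rw [QuotientGroup.eq, mem_fix0_iff]
  intro s
  have h := G21.maps_inv_zero (tauUnit_maps hij' (Stream'.cons false s))
  rw [reindex_swap_succ_cons] at h
  exact h.mul_zero (lift0_maps (tauUnit_maps hij s))

theorem schreierDist_one_le_of_mem_wordBall_tauG (hτ : tauG ⊆ S) {n : ℕ} {P : G21}
    (hP : P ∈ wordBall tauG n) : schreierDist S 1 P ≤ n := by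
  obtain ⟨k, hk, hPk⟩ := mem_wordBall_iff.1 hP
  suffices h : schreierDist S 1 P ≤ k from h.trans (by exact_mod_cast hk)
  clear hP hk
  induction k generalizing P with
  | zero =>
    rw [pow_zero, Set.mem_one] at hPk
    subst hPk
    exact schreierDist_one_le_iff.2 ⟨1, one_mem_wordBall, by rw [map_one]⟩
  | succ k ih =>
    rw [pow_succ] at hPk
    obtain ⟨Q, hQ, t, ht, rfl⟩ := hPk
    obtain ⟨i, j, hij, rfl⟩ := exists_eq_tauUnit ht
    exact schreierDist_one_mul_le (ih hQ) (schreierDist_one_tauUnit_le hτ hij)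

end SchreierDist

/-! ### Supports -/

/-- `a` shifts the letters by `d` positions, except that the letters at the positions in `A` are
rewritten in a way that depends on these letters only. The positions in `A` are counted before the
shift; they are integers because a shift to the right creates letters at negative positions. -/
def ShiftSupported (a : M21) (A : Finset ℤ) (d : ℤ) : Prop :=
  ∃ F : Stream' Bool → Stream' Bool, (∀ s, a.Maps s d (F s)) ∧
    (∀ s (j : ℕ), (j : ℤ) - d ∉ A → ∃ i : ℕ, (i : ℤ) = j - d ∧ (F s).get j = s.get i) ∧
    ∀ s s', (∀ i : ℕ, (i : ℤ) ∈ A → s.get i = s'.get i) →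
      ∀ j : ℕ, (j : ℤ) - d ∈ A → (F s).get j = (F s').get j

theorem shiftSupported_one : ShiftSupported 1 ∅ 0 :=
  ⟨fun s => s, M21.one_maps, fun _ j _ => ⟨j, by simp, rfl⟩, by simp⟩

theorem ShiftSupported.mul {a b : M21} {A B : Finset ℤ} {d e : ℤ} (ha : ShiftSupported a A d)
    (hb : ShiftSupported b B e) :
    ShiftSupported (a * b) (B ∪ A.image (· - e)) (e + d) := by
  obtain ⟨F, hF, hFoff, hFon⟩ := ha
  obtain ⟨G, hG, hGoff, hGon⟩ := hb
  have hmem : ∀ z : ℤ, z ∈ B ∪ A.image (· - e) ↔ z ∈ B ∨ z + e ∈ A := by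
    simp [sub_eq_iff_eq_add]
  refine ⟨fun s => F (G s), fun s => (hF _).mul (hG s), fun s j hj => ?_, fun s s' h j _ => ?_⟩
  · rw [hmem, not_or] at hj
    obtain ⟨i, hi, hFi⟩ := hFoff (G s) j (by convert hj.2 using 2; ring)
    obtain ⟨k, hk, hGk⟩ := hGoff s i (by convert hj.1 using 2; omega)
    exact ⟨k, by omega, hFi.trans hGk⟩
  · have hGeq : ∀ i : ℕ, (i : ℤ) - e ∈ B ∪ A.image (· - e) → (G s).get i = (G s').get i := by
      intro i hi
      by_cases hB : (i : ℤ) - e ∈ B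
      · exact hGon s s' (fun i hi => h i ((hmem _).2 (.inl hi))) i hB
      · obtain ⟨k, hk, hGk⟩ := hGoff s i hB
        obtain ⟨k', hk', hGk'⟩ := hGoff s' i hB
        obtain rfl : k = k' := by omega
        rw [hGk, hGk']
        exact h k (hk ▸ hi)
    by_cases hA : (j : ℤ) - d ∈ A
    · exact hFon _ _ (fun i hi => hGeq i ((hmem _).2 (.inr (by simpa using hi)))) j hA
    · obtain ⟨k, hk, hFk⟩ := hFoff (G s) j hA
      obtain ⟨k', hk', hFk'⟩ := hFoff (G s') j hA
      obtain rfl : k = k' := by omega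
      simp only [hFk, hFk']
      refine hGeq k ?_
      rwa [hk, sub_sub, add_comm]

theorem shiftSupported_tauUnit {i j : ℕ} (hij : i < j) :
    ShiftSupported (tauUnit i j hij) {(i : ℤ), (j : ℤ)} 0 := by
  refine ⟨reindex (Equiv.swap i j), tauUnit_maps hij, fun s q hq => ⟨q, by simp, ?_⟩,
    fun s s' h q hq => ?_⟩
  · simp only [sub_zero, Finset.mem_insert, Nat.cast_inj, Finset.mem_singleton, not_or] at hq
    rw [get_reindex, Equiv.swap_apply_of_ne_of_ne hq.1 hq.2]
  · simp only [sub_zero, Finset.mem_insert, Nat.cast_inj, Finset.mem_singleton] at hq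
    rw [get_reindex, get_reindex]
    rcases hq with rfl | rfl
    · exact h _ (by simp)
    · exact h _ (by simp)

theorem IsMaximalPrefixCode.mem_genIdeal {P : Set Word} (hP : IsMaximalPrefixCode P) {x : Word}
    (hx : ∀ p ∈ P, p.length ≤ x.length) : x ∈ genIdeal P := by
  by_contra hc
  have hcode : IsPrefixCode (insert x P) := by
    rintro u (rfl | hu) v (rfl | hv) h
    · rfl
    · exact h.eq_of_length_le (hx v hv)
    · exact absurd ⟨u, hu, h⟩ hc
    · exact hP.1 u hu v hv h
  have hxP : x ∈ P := hP.2 _ hcode (Set.subset_insert _ _) ▸ Set.mem_insert x P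
  exact hc ⟨x, hxP, List.prefix_refl x⟩

theorem exists_act_of_mem_lepM21 {a : M21} (ha : a ∈ lepM21) :
    ∃ (m : ℕ) (d : ℤ), ∀ x : Word, x.length = m →
      ∃ y, a.act x = some y ∧ (y.length : ℤ) = m + d := by
  obtain ⟨f, P, Q, hP, -, hPmax, -, hdom, -, hlep, rfl⟩ := ha
  obtain ⟨m, hm⟩ := (hP.image List.length).bddAbove
  have hm' : ∀ x : Word, x.length = m → x ∈ f.dom := fun x hx =>
    hdom ▸ hPmax.mem_genIdeal fun p hp => hx ▸ hm ⟨p, hp, rfl⟩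
  obtain ⟨y₀, hy₀⟩ := hm' (List.replicate m false) (by simp)
  refine ⟨m, y₀.length - m, fun x hx => ?_⟩
  obtain ⟨y, hy⟩ := hm' x hx
  have := hlep _ _ _ _ hy hy₀ (by simp [hx])
  exact ⟨y, f.essRestr_maxExt.1 _ _ hy, by omega⟩

theorem exists_shiftSupported {a : M21} (ha : a ∈ lepM21) : ∃ A d, ShiftSupported a A d := by
  obtain ⟨m, d, h⟩ := exists_act_of_mem_lepM21 ha
  choose! φ hφ hlen using h
  have hφ' := fun s : Stream' Bool => hφ (s.take m) (by simp)
  have hlen' := fun s : Stream' Bool => hlen (s.take m) (by simp)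
  have hd := abs_nonneg d
  refine ⟨Finset.Ico (-|d|) m, d, fun s => φ (s.take m) ++ₛ s.drop m, fun s => ?_,
    fun s j hj => ?_, fun s s' h j hj => ?_⟩
  · have hmaps := M21.maps_of_act (hφ' s) (s.drop m)
    rwa [Stream'.append_take_drop, hlen', Stream'.length_take, add_sub_cancel_left] at hmaps
  · have hs := hlen' s
    have := le_abs_self d
    rw [Finset.mem_Ico, not_and_or] at hj
    refine ⟨(j - d).toNat, by omega, ?_⟩
    rw [get_append_stream_of_length_le _ (by omega), Stream'.get_drop]
    congr 1
    omega
  · have hs := hlen' s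
    rw [Finset.mem_Ico] at hj
    have htake : s.take m = s'.take m := by
      refine List.ext_getElem? fun i => ?_
      rcases lt_or_ge i m with hi | hi
      · rw [Stream'.getElem?_take hi, Stream'.getElem?_take hi, h i (by rw [Finset.mem_Ico]; omega)]
      · rw [List.getElem?_eq_none (by simpa using hi), List.getElem?_eq_none (by simpa using hi)]
    simp only [← htake]
    rw [Stream'.get_append_left _ _ _ (by omega), Stream'.get_append_left _ _ _ (by omega)]

theorem exists_shiftSupported_of_mem_wordBall {T : Set M21} {c : ℕ}
    (hT : ∀ a ∈ T, ∃ A d, A.card ≤ c ∧ ShiftSupported a A d) {n : ℕ} {a : M21}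
    (ha : a ∈ wordBall T n) : ∃ A d, A.card ≤ n * c ∧ ShiftSupported a A d := by
  obtain ⟨k, hk, hak⟩ := mem_wordBall_iff.1 ha
  suffices h : ∃ A d, A.card ≤ k * c ∧ ShiftSupported a A d by
    obtain ⟨A, d, hA, h⟩ := h
    exact ⟨A, d, hA.trans (Nat.mul_le_mul_right c hk), h⟩
  clear ha hk
  induction k generalizing a with
  | zero =>
    rw [pow_zero, Set.mem_one] at hak
    exact ⟨∅, 0, by simp, hak ▸ shiftSupported_one⟩
  | succ k ih =>
    rw [pow_succ] at hak
    obtain ⟨a, ha, b, hb, rfl⟩ := hak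
    obtain ⟨A, d, hA, hAd⟩ := ih ha
    obtain ⟨B, e, hB, hBe⟩ := hT b hb
    refine ⟨_, _, (Finset.card_union_le _ _).trans ?_, hAd.mul hBe⟩
    have := Finset.card_image_le (s := A) (f := (· - e))
    rw [Nat.succ_mul]
    omega

/-- `a` rewrites the letters at the positions in `A` in a way that depends on these letters only,
and fixes all other letters. -/
def SupportedOn (a : M21) (A : Finset ℕ) : Prop :=
  ∃ F : Stream' Bool → Stream' Bool, (∀ s, a.Maps s 0 (F s)) ∧
    (∀ s, ∀ j ∉ A, (F s).get j = s.get j) ∧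
    ∀ s s', (∀ i ∈ A, s.get i = s'.get i) → ∀ j ∈ A, (F s).get j = (F s').get j

theorem ShiftSupported.exists_supportedOn {a : M21} {A : Finset ℤ} (h : ShiftSupported a A 0) :
    ∃ B : Finset ℕ, B.card ≤ A.card ∧ SupportedOn a B := by
  obtain ⟨F, hF, hoff, hon⟩ := h
  have hmem : ∀ i : ℕ, i ∈ A.preimage (Nat.cast : ℕ → ℤ) Nat.cast_injective.injOn ↔
    (i : ℤ) ∈ A := fun i => Finset.mem_preimage
  refine ⟨_, Finset.card_le_card_of_injOn Nat.cast (fun i hi => (hmem i).1 hi)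
    Nat.cast_injective.injOn, F, hF, fun s j hj => ?_, fun s s' h j hj => ?_⟩
  · obtain ⟨i, hi, h⟩ := hoff s j (by rwa [sub_zero, ← hmem])
    obtain rfl : i = j := by omega
    exact h
  · exact hon s s' (fun i hi => h i ((hmem i).2 hi)) j (by rwa [sub_zero, ← hmem])

theorem exists_supportedOn_of_mem_lpG21 {Γ : Set M21} (hΓ : Γ.Finite) (hΓL : Γ ⊆ lepM21) :
    ∃ c, ∀ n, ∀ g ∈ lpG21, (g : M21) ∈ wordBall (Γ ∪ tauM) n →
      ∃ A : Finset ℕ, A.card ≤ n * c ∧ SupportedOn g A := by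
  choose! A d hA using fun a (ha : a ∈ Γ) => exists_shiftSupported (hΓL ha)
  obtain ⟨c, hc⟩ := (hΓ.image fun a => (A a).card).bddAbove
  have hgen : ∀ a ∈ Γ ∪ tauM, ∃ A d, A.card ≤ max c 2 ∧ ShiftSupported a A d := by
    rintro a (ha | ⟨i, j, hij, rfl⟩)
    · exact ⟨_, _, (hc ⟨a, ha, rfl⟩).trans (le_max_left _ _), hA a ha⟩
    · exact ⟨_, _, Finset.card_le_two.trans (le_max_right _ _), shiftSupported_tauUnit hij⟩
  refine ⟨max c 2, fun n g hg hgn => ?_⟩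
  obtain ⟨A, d, hAcard, hAd⟩ := exists_shiftSupported_of_mem_wordBall hgen hgn
  obtain rfl : d = 0 := by
    obtain ⟨F, hF, -⟩ := hAd
    exact mem_lpG21_iff.1 hg _ _ _ (hF (Stream'.const false))
  obtain ⟨B, hB, hBg⟩ := hAd.exists_supportedOn
  exact ⟨B, hB.trans hAcard, hBg⟩

theorem SupportedOn.conj {g P : G21} {A B : Finset ℕ} (h : SupportedOn g A) (π : Equiv.Perm ℕ)
    (hP : ∀ s, (P : M21).Maps s 0 (reindex π s)) (hAB : ∀ q, q ∈ B ↔ π q ∈ A) :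
    SupportedOn (P * g * P⁻¹ : G21) B := by
  obtain ⟨F, hF, hoff, hon⟩ := h
  have hPinv : ∀ s, (↑P⁻¹ : M21).Maps s 0 (reindex π.symm s) := by
    intro s
    have hπ : reindex π (reindex π.symm s) = s :=
      Stream'.ext fun q => by simp only [get_reindex, π.symm_apply_apply]
    have h := hP (reindex π.symm s)
    rw [hπ] at h
    exact G21.maps_inv_zero h
  refine ⟨fun s => reindex π (F (reindex π.symm s)),
    fun s => ((hP _).mul_zero (hF _)).mul_zero (hPinv s), fun s q hq => ?_, fun s s' h q hq => ?_⟩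
  · rw [get_reindex, hoff _ _ (hq ∘ (hAB q).2), get_reindex, π.symm_apply_apply]
  · rw [get_reindex, get_reindex]
    refine hon (reindex π.symm s) (reindex π.symm s') (fun i hi => h _ ?_) _ ((hAB q).1 hq)
    rwa [hAB, π.apply_symm_apply]

theorem SupportedOn.exists_conj_range {g : G21} {A : Finset ℕ} (h : SupportedOn g A) :
    ∃ P ∈ wordBall tauG A.card, SupportedOn (P * g * P⁻¹ : G21) (Finset.range A.card) := by
  obtain ⟨π, P, hP, hPπ, hπ⟩ := exists_maps_perm (A.orderEmbOfFin rfl)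
    (A.orderEmbOfFin rfl).injective
  refine ⟨P, hP, h.conj π hPπ fun q => ?_⟩
  rw [Finset.mem_range]
  constructor
  · intro hq
    exact hπ ⟨q, hq⟩ ▸ A.orderEmbOfFin_mem rfl _
  · intro hq
    obtain ⟨i, hi⟩ : π q ∈ Set.range (A.orderEmbOfFin rfl) := by
      rwa [Finset.range_orderEmbOfFin]
    rw [← hπ, π.injective.eq_iff] at hi
    exact hi ▸ i.2

theorem finite_setOf_supportedOn (A : Finset ℕ) : {a : M21 | SupportedOn a A}.Finite := by
  let graph : M21 → Set ((A → Bool) × (A → Bool)) := fun a =>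
    {xy | ∃ s t, a.Maps s 0 t ∧ (fun i : A => s.get i) = xy.1 ∧ (fun i : A => t.get i) = xy.2}
  refine Set.Finite.of_finite_image (f := graph) (Set.toFinite _) ?_
  rintro a ⟨F, hF, hFoff, -⟩ b ⟨G, hG, hGoff, hGon⟩ hab
  refine M21.ext_of_exists_maps fun s => ⟨0, F s, hF s, ?_⟩
  suffices h : F s = G s from h ▸ hG s
  refine Stream'.ext fun j => ?_
  by_cases hj : j ∈ A
  · have hs : (fun i : A => s.get i, fun i : A => (F s).get i) ∈ graph b :=
      hab ▸ ⟨s, F s, hF s, rfl, rfl⟩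
    obtain ⟨s', t, hst, hs', ht⟩ := hs
    obtain ⟨-, rfl⟩ := hst.unique (hG s')
    exact (congrFun ht ⟨j, hj⟩).symm.trans
      (hGon s' s (fun i hi => congrFun hs' ⟨i, hi⟩) j hj)
  · rw [hFoff s j hj, hGoff s j hj]

/-- Up to conjugation by position transpositions, which costs a bounded number of generators, only
finitely many elements have to be considered. -/
theorem exists_schreierDist_one_le_of_mem_wordBall {S : Set G21} (hτ : tauG ⊆ S)
    (hS : Submonoid.closure S = ⊤) {Γ : Set M21} (hΓ : Γ.Finite) (hΓL : Γ ⊆ lepM21) (n : ℕ) :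
    ∃ B : ℕ, ∀ g ∈ lpG21, (g : M21) ∈ wordBall (Γ ∪ tauM) n → schreierDist S 1 g ≤ B := by
  obtain ⟨c, hc⟩ := exists_supportedOn_of_mem_lpG21 hΓ hΓL
  choose N hN using exists_schreierDist_one_le hS
  have hfin : {g : G21 | ∃ r ≤ n * c, SupportedOn g (Finset.range r)}.Finite := by
    have h := (Set.finite_Iic (n * c)).biUnion fun r _ => finite_setOf_supportedOn (Finset.range r)
    convert h.preimage (Units.val_injective (α := M21)).injOn using 1
    ext g
    simp
  obtain ⟨B, hB⟩ := (hfin.image N).bddAbove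
  refine ⟨n * c + B + n * c, fun g hg hgn => ?_⟩
  obtain ⟨A, hA, hgA⟩ := hc n g hg hgn
  obtain ⟨P, hP, hPg⟩ := hgA.exists_conj_range
  have hconj : schreierDist S 1 (P * g * P⁻¹) ≤ B :=
    (hN _).trans (by exact_mod_cast hB ⟨_, ⟨_, hA, hPg⟩, rfl⟩)
  replace hP := wordBall_mono hA hP
  have key := schreierDist_one_mul_le (schreierDist_one_mul_le
    (schreierDist_one_le_of_mem_wordBall_tauG hτ (inv_mem_wordBall (fun _ => inv_mem_tauG) hP))
    hconj) (schreierDist_one_le_of_mem_wordBall_tauG hτ hP)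
  rwa [show P⁻¹ * (P * g * P⁻¹) * P = g by group] at key

theorem submonoid_closure_eq_top {G : Type*} [Group G] {S : Set G} (hS : ∀ s ∈ S, s⁻¹ ∈ S)
    (h : Subgroup.closure S = ⊤) : Submonoid.closure S = ⊤ := by
  have hSinv : S ∪ S⁻¹ = S := Set.union_eq_left.2 fun s hs => inv_inv s ▸ hS _ hs
  rw [← hSinv, ← Subgroup.closure_toSubmonoid, h, Subgroup.top_toSubmonoid]

section Distortion

variable {S : Set G21} {Γ T T' : Set M21} {m n : ℕ}

theorem distortion_le_distortion
    (h : ∀ g ∈ lpG21, (g : M21) ∈ wordBall T n → (g : M21) ∈ wordBall T' m) :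
    distortion S T n ≤ distortion S T' m := by
  refine iSup₂_le fun g hg => ?_
  exact le_iSup₂ (f := fun (g : G21) (_ : g ∈ lpG21 ∧ wordLength T' (g : M21) ≤ m) =>
    schreierDist S 1 g) g ⟨hg.1, h g hg.1 hg.2⟩

theorem distortion_mono (h : T ⊆ T') : distortion S T n ≤ distortion S T' n := by
  refine distortion_le_distortion fun g _ hg => ?_
  simpa using wordBall_subset_wordBall (h.trans subset_wordBall_one) hg

theorem distortion_ne_top (hτ : tauG ⊆ S) (hS : Submonoid.closure S = ⊤) (hΓ : Γ.Finite)
    (hΓL : Γ ⊆ lepM21) (n : ℕ) : distortion S (Γ ∪ tauM) n ≠ ⊤ := by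
  obtain ⟨B, hB⟩ := exists_schreierDist_one_le_of_mem_wordBall hτ hS hΓ hΓL n
  exact ne_top_of_le_ne_top (ENat.natCast_ne_top B) (iSup₂_le fun g hg => hB g hg.1 hg.2)

theorem exists_distortion_le_linear (S : Set G21) (hτ : tauM ⊆ T) (hΓ : Γ.Finite)
    (hΓT : Γ ⊆ Submonoid.closure T) :
    ∃ c, 1 ≤ c ∧ ∀ n, distortion S (Γ ∪ tauM) n ≤ distortion S T (c * n) := by
  obtain ⟨c, hc⟩ := exists_subset_wordBall hΓ hΓT
  have hsub : Γ ∪ tauM ⊆ wordBall T (c + 1) :=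
    Set.union_subset (hc.trans (wordBall_mono (by omega)))
      (hτ.trans (subset_wordBall_one.trans (wordBall_mono (by omega))))
  refine ⟨c + 1, by omega, fun n => distortion_le_distortion fun g _ hg => ?_⟩
  rw [mul_comm]
  exact wordBall_subset_wordBall hsub hg

theorem exists_distortion_le_quadratic (S : Set G21) (hτ : tauM ⊆ T)
    (hT : lepM21 ⊆ Submonoid.closure T) (hΓ : Γ.Finite) :
    ∃ C, 1 ≤ C ∧ ∀ n, distortion S (Γ ∪ tauM) n ≤ distortion S T (C * n ^ 2) := by
  obtain ⟨C, hC⟩ := exists_mem_wordBall_quadratic hτ hT hΓ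
  refine ⟨C + 1, by omega, fun n => distortion_le_distortion fun g hg hgn => ?_⟩
  exact wordBall_mono (Nat.mul_le_mul_right _ C.le_succ) (hC n g hg hgn)

end Distortion

theorem polyEquiv_of_le_linear_of_le_quadratic {f₁ f₂ : ℕ → ℕ∞} {c C : ℕ} (hc : 1 ≤ c)
    (hC : 1 ≤ C) (h₁ : ∀ n, f₁ n ≤ f₂ (c * n)) (h₂ : ∀ n, f₂ n ≤ f₁ (C * n ^ 2)) :
    PolyEquiv f₁ f₂ := by
  have hle_mul : ∀ (a : ℕ) (x : ℕ∞), 1 ≤ a → x ≤ a * x := fun a x ha =>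
    le_mul_of_one_le_left zero_le (by exact_mod_cast ha)
  have hle_sq : ∀ x : ℕ∞, x ≤ x ^ 2 := by
    intro x
    rcases eq_or_ne x 0 with rfl | hx
    · exact zero_le
    · exact le_self_pow (Order.one_le_iff_ne_zero.2 hx) two_ne_zero
  refine ⟨1, c, C, 1, 2, one_pos, hc, hC, one_pos, two_pos, fun n _ => ⟨?_, ?_⟩⟩
  · rw [pow_one, pow_one]
    exact (h₁ n).trans (hle_mul c _ hc)
  · exact (h₂ n).trans ((hle_sq _).trans (hle_mul C _ hC))

end Thompson

theorem mainTheorem11_general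
    (ΓG : Set Thompson.G21) (ΓL ΓM : Set Thompson.M21)
    (hGgen : Submonoid.closure (ΓG ∪ Thompson.tauG) = ⊤)
    (hLfin : ΓL.Finite)
    (hLgen : (Submonoid.closure (ΓL ∪ Thompson.tauM) : Set Thompson.M21) = Thompson.lepM21)
    (hMfin : ΓM.Finite)
    (hMgen : ΓL ⊆ Submonoid.closure (ΓM ∪ Thompson.tauM))
    (Δ δ : ℕ → ℕ∞)
    (hΔ : Δ = Thompson.distortion (ΓG ∪ Thompson.tauG) (ΓL ∪ Thompson.tauM))
    (hδ : δ = Thompson.distortion (ΓG ∪ Thompson.tauG) (ΓM ∪ Thompson.tauM)) :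
    (∀ n : ℕ, Δ n ≠ ⊤ ∧ δ n ≠ ⊤) ∧
    Thompson.PolyEquiv Δ δ ∧
    (∃ c₀ c' c₁ c₂ : ℕ, 1 ≤ c₀ ∧ 1 ≤ c' ∧ 1 ≤ c₁ ∧ 1 ≤ c₂ ∧ ∀ n : ℕ,
      Δ n ≤ c₁ * δ (c₀ * n) ∧ c₁ * δ (c₀ * n) ≤ c₂ * Δ (c' * n ^ 2)) ∧
    (ΓL ⊆ ΓM ∪ Thompson.tauM →
      ∃ c' c₁ c₂ : ℕ, 1 ≤ c' ∧ 1 ≤ c₁ ∧ 1 ≤ c₂ ∧ ∀ n : ℕ,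
        Δ n ≤ c₁ * δ n ∧ c₁ * δ n ≤ c₂ * Δ (c' * n ^ 2)) := by
  have hΓL : ΓL ⊆ Thompson.lepM21 := fun x hx =>
    hLgen ▸ Submonoid.subset_closure (Set.mem_union_left _ hx)
  obtain ⟨c, hc, hΔδ⟩ : ∃ c, 1 ≤ c ∧ ∀ n, Δ n ≤ δ (c * n) := hΔ ▸ hδ ▸
    Thompson.exists_distortion_le_linear _ Set.subset_union_right hLfin hMgen
  obtain ⟨C, hC, hδΔ⟩ : ∃ C, 1 ≤ C ∧ ∀ n, δ n ≤ Δ (C * n ^ 2) := hΔ ▸ hδ ▸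
    Thompson.exists_distortion_le_quadratic _ Set.subset_union_right hLgen.ge hMfin
  have hΔfin : ∀ n, Δ n ≠ ⊤ := hΔ ▸
    Thompson.distortion_ne_top Set.subset_union_right hGgen hLfin hΓL
  refine ⟨fun n => ⟨hΔfin n, ne_top_of_le_ne_top (hΔfin _) (hδΔ n)⟩,
    Thompson.polyEquiv_of_le_linear_of_le_quadratic hc hC hΔδ hδΔ,
    ⟨c, C * c ^ 2, 1, 1, hc, Nat.mul_pos hC (pow_pos hc 2), le_rfl, le_rfl, fun n => ?_⟩,
    fun hsub => ⟨C, 1, 1, hC, le_rfl, le_rfl, fun n => ?_⟩⟩ <;>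
    rw [Nat.cast_one, one_mul, one_mul]
  · exact ⟨hΔδ n, by simpa only [mul_pow, mul_assoc] using hδΔ (c * n)⟩
  · refine ⟨?_, hδΔ n⟩
    rw [hΔ, hδ]
    exact Thompson.distortion_mono (Set.union_subset hsub Set.subset_union_right)

theorem mainTheorem11
    (ΓG : Set Thompson.G21) (ΓL ΓM : Set Thompson.M21)
    (hGfin : ΓG.Finite) (hGsymm : ∀ γ ∈ ΓG, γ⁻¹ ∈ ΓG)
    (hGgen : Subgroup.closure (ΓG ∪ Thompson.tauG) = ⊤)
    (hLfin : ΓL.Finite)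
    (hLgen : (Submonoid.closure (ΓL ∪ Thompson.tauM) : Set Thompson.M21) = Thompson.lepM21)
    (hMfin : ΓM.Finite)
    (hMgen : Submonoid.closure (ΓM ∪ Thompson.tauM) = ⊤)
    (Δ δ : ℕ → ℕ∞)
    (hΔ : Δ = Thompson.distortion (ΓG ∪ Thompson.tauG) (ΓL ∪ Thompson.tauM))
    (hδ : δ = Thompson.distortion (ΓG ∪ Thompson.tauG) (ΓM ∪ Thompson.tauM)) :
    (∀ n : ℕ, Δ n ≠ ⊤ ∧ δ n ≠ ⊤) ∧
    Thompson.PolyEquiv Δ δ ∧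
    (∃ c₀ c' c₁ c₂ : ℕ, 1 ≤ c₀ ∧ 1 ≤ c' ∧ 1 ≤ c₁ ∧ 1 ≤ c₂ ∧ ∀ n : ℕ,
      Δ n ≤ c₁ * δ (c₀ * n) ∧ c₁ * δ (c₀ * n) ≤ c₂ * Δ (c' * n ^ 2)) ∧
    (ΓL ⊆ ΓM ∪ Thompson.tauM →
      ∃ c' c₁ c₂ : ℕ, 1 ≤ c' ∧ 1 ≤ c₁ ∧ 1 ≤ c₂ ∧ ∀ n : ℕ,
        Δ n ≤ c₁ * δ n ∧ c₁ * δ n ≤ c₂ * Δ (c' * n ^ 2)) :=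
  mainTheorem11_general ΓG ΓL ΓM
    (Thompson.submonoid_closure_eq_top
      (fun _ hγ => hγ.imp (hGsymm _) Thompson.inv_mem_tauG) hGgen)
    hLfin hLgen hMfin (fun x _ => hMgen ▸ Submonoid.mem_top x) Δ δ hΔ hδ
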